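/- Let $p$ be a prime, $n\ge 1$, and let $k$ be a nonzero perfect $\mathbb{F}_p$-algebra (a commutative ring of characteristic $p$ whose Frobenius $a\mapsto a^p$ is bijective). Let $W_n(-)$ denote $p$-typical Witt vectors of length $n$ and let $\Phi\colon W_n(k)\to W_n(k)$ be the Witt vector Frobenius. Let $X$ be a smooth $k$-scheme and let $X'$ be a smooth $W_n(k)$-scheme lifting $X$, i.e. given with an isomorphism $X\cong X'\times_{\mathrm{Spec}\,W_n(k)}\mathrm{Spec}\,k$, the base change being along the projection $W_n(k)\to k$, $(a_1,\dots,a_n)\mapsto a_1$. Then the resulting map $X\to X'$ is a homeomorphism, by which we regard the sheaf $W_n\mathcal{O}_X\colon U\mapsto W_n(\mathcal{O}_X(U))$ as a sheaf of rings on $X'$, and the following holds. There is exactly one morphism of sheaves of sets $$\tilde F^n\colon W_n\mathcal{O}_X\to\mathcal{O}_{X'},\qquad (x_1,\dots,x_n)\mapsto\sum_{i=0}^{n-1}p^i\,\tilde x_{i+1}^{\,p^{n-i}},$$ given by this formula whenever $\tilde x_1,\dots,\tilde x_n\in\mathcal{O}_{X'}(U)$ lift the sections $x_1,\dots,x_n$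 over an open set $U$ (such lifts exist locally, and the value does not depend on their choice). It is an injective morphism of sheaves of rings, it is $\Phi^n$-semilinear, i.e. $\tilde F^n(a\cdot x)=\Phi^n(a)\,\tilde F^n(x)$ for all $a\in W_n(k)$ and all sections $x$, and it induces an isomorphism of $W_n\mathcal{O}_X$ onto the kernel of the de Rham differential $d\colon\mathcal{O}_{X'}\to\Omega^1_{X'/W_n(k)}$; that is, over every open set it is a bijection onto the sections killed by $d$. -/

import Mathlib

open CategoryTheory AlgebraicGeometry TopologicalSpace Opposite

universe u

noncomputable section

namespace TruncatedWittVector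

variable {p : ℕ} [Fact p.Prime] {n : ℕ} {R S T : Type*} [CommRing R] [CommRing S] [CommRing T]

/-- Functoriality of truncated Witt vectors: `W_n(f)` applies `f` to every component. -/
def map (f : R →+* S) : TruncatedWittVector p n R →+* TruncatedWittVector p n S where
  toFun x := mk p fun i => f (x.coeff i)
  map_one' := by
    ext i
    have h : (1 : TruncatedWittVector p n R) = WittVector.truncate n 1 := (map_one _).symm
    have h' : (1 : TruncatedWittVector p n S) = WittVector.truncate n (WittVector.map f 1) := by
      rw [map_one, map_one]
    rw [h, h', coeff_mk, WittVector.coeff_truncate, WittVector.coeff_truncate, WittVector.map_coeff]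
  map_zero' := by
    ext i
    rw [coeff_mk, coeff_zero, coeff_zero, map_zero]
  map_mul' x y := by
    obtain ⟨x, rfl⟩ := WittVector.truncate_surjective p n R x
    obtain ⟨y, rfl⟩ := WittVector.truncate_surjective p n R y
    have h : ∀ z : WittVector p R, (mk p fun i => f ((WittVector.truncate n z).coeff i)) =
        WittVector.truncate n (WittVector.map f z) := fun z => by
      ext i
      rw [coeff_mk, WittVector.coeff_truncate, WittVector.coeff_truncate, WittVector.map_coeff]
    rw [← map_mul, h, h, h, map_mul, map_mul]
  map_add' x y := by
    obtain ⟨x, rfl⟩ := WittVector.truncate_surjective p n R x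
    obtain ⟨y, rfl⟩ := WittVector.truncate_surjective p n R y
    have h : ∀ z : WittVector p R, (mk p fun i => f ((WittVector.truncate n z).coeff i)) =
        WittVector.truncate n (WittVector.map f z) := fun z => by
      ext i
      rw [coeff_mk, WittVector.coeff_truncate, WittVector.coeff_truncate, WittVector.map_coeff]
    rw [← map_add, h, h, h, map_add, map_add]

@[simp]
theorem coeff_map (f : R →+* S) (x : TruncatedWittVector p n R) (i : Fin n) :
    (map f x).coeff i = f (x.coeff i) := rfl

theorem map_id : map (RingHom.id R) = RingHom.id (TruncatedWittVector p n R) := rfl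

theorem map_comp (g : S →+* T) (f : R →+* S) :
    (map (g.comp f) : TruncatedWittVector p n R →+* _) = (map g).comp (map f) := rfl

/-- The projection `W_n(R) → R`, `(x_1, …, x_n) ↦ x_1`, for `n ≥ 1`. -/
def firstCoeff [NeZero n] : TruncatedWittVector p n R →+* R where
  toFun x := x.coeff 0
  map_one' := by
    rw [← map_one (WittVector.truncate n), WittVector.coeff_truncate]
    exact WittVector.one_coeff_zero p R
  map_zero' := coeff_zero p n R 0
  map_mul' x y := by
    obtain ⟨x, rfl⟩ := WittVector.truncate_surjective p n R x
    obtain ⟨y, rfl⟩ := WittVector.truncate_surjective p n R y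
    rw [← map_mul, WittVector.coeff_truncate, WittVector.coeff_truncate, WittVector.coeff_truncate]
    exact WittVector.mul_coeff_zero x y
  map_add' x y := by
    obtain ⟨x, rfl⟩ := WittVector.truncate_surjective p n R x
    obtain ⟨y, rfl⟩ := WittVector.truncate_surjective p n R y
    rw [← map_add, WittVector.coeff_truncate, WittVector.coeff_truncate, WittVector.coeff_truncate]
    exact WittVector.add_coeff_zero x y

/-- The Witt vector Frobenius `Φ : W_n(k) → W_n(k)` of a ring `k` of characteristic `p`,
`(a_1, …, a_n) ↦ (a_1 ^ p, …, a_n ^ p)`. -/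
def frobeniusMap (p : ℕ) [Fact p.Prime] (n : ℕ) (k : Type*) [CommRing k] [CharP k p] :
    TruncatedWittVector p n k →+* TruncatedWittVector p n k :=
  map (_root_.frobenius k p)

/-- `frobeniusMap` is induced by the Frobenius of the full ring of Witt vectors. -/
theorem frobeniusMap_truncate {k : Type*} [CommRing k] [CharP k p] (x : WittVector p k) :
    frobeniusMap p n k (WittVector.truncate n x) =
      WittVector.truncate n (WittVector.frobenius x) := by
  ext i
  rw [frobeniusMap, coeff_map, WittVector.coeff_truncate, WittVector.coeff_truncate,
    WittVector.coeff_frobenius_charP]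
  rfl

end TruncatedWittVector

namespace AlgebraicGeometry.Scheme

variable (p : ℕ) [Fact p.Prime] (n : ℕ)

/-- The presheaf of rings `U ↦ W_n(Γ(X, U))`. -/
def wittPresheaf (X : Scheme.{u}) : TopCat.Presheaf CommRingCat.{u} X where
  obj U := CommRingCat.of (TruncatedWittVector p n (X.presheaf.obj U))
  map f := CommRingCat.ofHom (TruncatedWittVector.map (X.presheaf.map f).hom)
  map_id U := by
    rw [X.presheaf.map_id]
    rfl
  map_comp f g := by
    rw [X.presheaf.map_comp]
    rfl

theorem wittPresheaf_isSheaf (X : Scheme.{u}) : (X.wittPresheaf p n).IsSheaf := by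
  rw [TopCat.Presheaf.isSheaf_iff_isSheafUniqueGluing]
  intro ι U sf hsf
  have key : ∀ j : Fin n, ∃! s : X.presheaf.obj (op (iSup U)),
      TopCat.Presheaf.IsGluing X.presheaf U
        (fun i => TruncatedWittVector.coeff j (sf i)) s := fun j =>
    X.sheaf.existsUnique_gluing U _
      fun i i' => congrArg (TruncatedWittVector.coeff (p := p)
        (R := X.presheaf.obj (op (U i ⊓ U i'))) j) (hsf i i')
  choose s hs huniq using key
  refine ⟨TruncatedWittVector.mk p s, fun i => ?_, fun t ht => ?_⟩
  · exact TruncatedWittVector.ext fun j => hs j i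
  · exact TruncatedWittVector.ext fun j =>
      huniq j _ fun i => congrArg (TruncatedWittVector.coeff j) (ht i)

/-- The sheaf of rings `W_n 𝒪_X` on `X`. -/
def wittSheaf (X : Scheme.{u}) : TopCat.Sheaf CommRingCat.{u} X :=
  ⟨X.wittPresheaf p n, X.wittPresheaf_isSheaf p n⟩

end AlgebraicGeometry.Scheme

namespace AlgebraicGeometry

section Structure

variable {R : Type u} [CommRing R] {X : Scheme.{u}} (f : X ⟶ Spec (CommRingCat.of R))

/-- For a scheme `f : X ⟶ Spec R`, the structure map from the constant presheaf `R` to `𝒪_X`. -/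
def structureMap : (Functor.const _).obj (CommRingCat.of R) ⟶ X.presheaf where
  app U := (Scheme.ΓSpecIso (CommRingCat.of R)).inv ≫ f.appTop ≫
    X.presheaf.map (homOfLE le_top : U.unop ⟶ ⊤).op
  naturality U V g := by
    simp only [Functor.const_obj_obj, Functor.const_obj_map, Category.id_comp, Category.assoc,
      ← X.presheaf.map_comp]
    rfl

/-- The `R`-algebra structure map `R → Γ(X, U)`. -/
def algMap (U : X.Opens) : R →+* Γ(X, U) := ((structureMap f).app (op U)).hom

/-- The presheaf of modules `U ↦ Ω¹_{Γ(X, U)/R}` of Kähler differentials. -/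
def kaehlerPresheaf : X.PresheafOfModules :=
  PresheafOfModules.DifferentialsConstruction.relativeDifferentials' (structureMap f)

/-- The sheaf of differentials `Ω¹_{X/R}`: the sheaf of `𝒪_X`-modules associated with
`U ↦ Ω¹_{Γ(X, U)/R}`. -/
def kaehlerSheaf : X.Modules :=
  (PresheafOfModules.sheafification (𝟙 X.ringCatSheaf.obj)).obj (kaehlerPresheaf f)

/-- The canonical map from Kähler differentials of `Γ(X, U)` over `R` to `Γ(U, Ω¹_{X/R})`. -/
def toKaehlerSheaf (U : X.Opens) :
    (kaehlerPresheaf f).presheaf.obj (op U) ⟶ (kaehlerSheaf f).presheaf.obj (op U) :=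
  ((PresheafOfModules.toPresheaf _).map
    ((PresheafOfModules.sheafificationAdjunction (𝟙 X.ringCatSheaf.obj)).unit.app
      (kaehlerPresheaf f))).app (op U)

/-- The de Rham differential `d : 𝒪_X → Ω¹_{X/R}` on sections over `U`. -/
def deRhamD (U : X.Opens) : Γ(X, U) →+ (kaehlerSheaf f).presheaf.obj (op U) :=
  (toKaehlerSheaf f U).hom.comp
    (PresheafOfModules.DifferentialsConstruction.derivation' (structureMap f)).d

end Structure

section Frobenius

variable (p : ℕ) [Fact p.Prime] (n : ℕ) {X X' : Scheme.{u}} (i : X ⟶ X')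

/-- For `i : X ⟶ X'` (a homeomorphism in the case of interest), `W_n 𝒪_X` viewed as a sheaf of
rings on `X'`; its ring of sections over `U` is `W_n(Γ(X, i⁻¹ U))`. -/
def wittSheafOn : TopCat.Sheaf CommRingCat.{u} X' :=
  (TopCat.Sheaf.pushforward CommRingCat i.base).obj (X.wittSheaf p n)

/-- A map of sheaves of sets `W_n 𝒪_X → 𝒪_{X'}` is given by the formula
`(x_1, …, x_n) ↦ ∑ p ^ j * x̃_{j+1} ^ (p ^ (n - j))`, `j = 0, …, n - 1`, for all sections
`x_1, …, x_n` over an open set and all lifts `x̃_1, …, x̃_n` over that open set. -/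
def IsTildeF (φ : (wittSheafOn p n i).obj ⋙ forget CommRingCat.{u} ⟶
    X'.presheaf ⋙ forget CommRingCat.{u}) : Prop :=
  ∀ (U : X'.Opens) (x : TruncatedWittVector p n Γ(X, i ⁻¹ᵁ U)) (y : Fin n → Γ(X', U)),
    (∀ j, i.app U (y j) = x.coeff j) →
      φ.app (op U) x = (∑ j : Fin n, (p : Γ(X', U)) ^ (j : ℕ) * y j ^ p ^ (n - (j : ℕ)) : Γ(X', U))

variable {p n i}

/-- The ring homomorphism `W_n(Γ(X, i⁻¹ U)) → Γ(X', U)` on sections over `U`. -/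
def onSections (F : wittSheafOn p n i ⟶ X'.sheaf) (U : X'.Opens) :
    TruncatedWittVector p n Γ(X, i ⁻¹ᵁ U) →+* Γ(X', U) :=
  (F.hom.app (op U)).hom

end Frobenius

end AlgebraicGeometry

end

/-!
Over an affine open subset, `B = 𝒪_{X'}(U)` is flat over `ℤ / p ^ n` with reduction
`R = 𝒪_X(U) = B / p`, and the ghost component `w_n : W(B) → B` vanishes on Witt vectors whose first
`n` coefficients are divisible by `p`. Hence it factors through a ring homomorphism `W_n(R) → B`,
which is `F̃ⁿ`; for `B = W_n(k)` it is `Φⁿ`, as one sees on Teichmüller representatives. It is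
injective because `R` is reduced: the coefficients of an element of the kernel vanish one by one.

Its values are closed, as `d (w_n z) = p ^ n ∑ z_j ^ (p ^ (n - j) - 1) d z_j = 0`. Conversely, one
shows by induction on `m` that every closed `b : B` is of the form `w_m z` for `m ≤ n`. Let
`b = w_m z` with `m < n`. Dividing `d b = 0` by `p ^ m` gives
`∑ x_j ^ (p ^ (m - j) - 1) d x_j = 0` for the classes `x_j : R` of the `z_j`. For the derivation
`D` dual to a member of a `p`-basis one has `D ^ (p - 1) (f ^ (p - 1) * D f) = -(D f) ^ p` and
`D ^ p = 0`, so applying `D ^ (p - 1)` amounts to applying the Cartier operator, and iterating it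
shows that every `x_j` is closed. Therefore `x_j` is a `p`-th power, say of the class of
`y_j : B`. Then `b` is congruent to `∑ p ^ j * y_j ^ (p ^ (m + 1 - j))` modulo `p ^ (m + 1)`, that
is, `b` is a value of `w_{m + 1}`.
-/

section OneVariable

theorem derivation_iterate_mul_of_apply_eq_zero {A R : Type*} [CommRing A] [CommRing R]
    [Algebra A R] (D : Derivation A R R) {c : R} (hc : D c = 0) (m : ℕ) (y : R) :
    D^[m] (c * y) = c * D^[m] y := by
  have hD (y : R) : D (c * y) = c * D y := by rw [D.leibniz, hc, smul_zero, add_zero, smul_eq_mul]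
  exact ((show Function.Semiconj (c * ·) D D from fun y => (hD y).symm).iterate_right m y).symm

theorem derivation_iterate_map_sum {A R ι : Type*} [CommRing A] [CommRing R] [Algebra A R]
    (D : Derivation A R R) (m : ℕ) (s : Finset ι) (g : ι → R) :
    D^[m] (∑ j ∈ s, g j) = ∑ j ∈ s, D^[m] (g j) := by
  have hD (y : R) : D^[m] y = ((D : R →ₗ[A] R) ^ m) y := by rw [Module.End.pow_apply]; rfl
  simp only [hD, map_sum]

theorem derivation_iterate_pow_of_apply_eq_one {A R : Type*} [CommRing A] [CommRing R] [Algebra A R]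
    (D : Derivation A R R) {x : R} (hx : D x = 1) (j m : ℕ) :
    D^[j] (x ^ m) = m.descFactorial j * x ^ (m - j) := by
  induction j with
  | zero => simp
  | succ j ih =>
    rw [Function.iterate_succ_apply', ih, D.leibniz, D.leibniz_pow, hx, D.map_natCast,
      Nat.descFactorial_succ, Nat.sub_sub]
    simp only [smul_eq_mul, nsmul_eq_mul, mul_one, mul_zero, add_zero, Nat.cast_mul]
    ring

-- In the universal case `ℤ[u, v]`, whose differentials are torsion-free, the identity is obtained
-- by dividing `d ((u + v) ^ p) = d (u ^ p) + d (v ^ p) + p • d (u * v * w)` by `p`.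
theorem exists_pow_pred_smul_derivation_add_eq (p : ℕ) [hp : Fact p.Prime] {A R M : Type*}
    [CommRing A] [CommRing R] [Algebra A R] [AddCommGroup M] [Module A M] [Module R M]
    (D : Derivation A R M) (f g : R) :
    ∃ h, (f + g) ^ (p - 1) • D (f + g) = f ^ (p - 1) • D f + g ^ (p - 1) • D g + D h := by
  let P := MvPolynomial (Fin 2) ℤ
  let u : P := MvPolynomial.X 0
  let v : P := MvPolynomial.X 1
  let d := KaehlerDifferential.D ℤ P
  obtain ⟨w, hw⟩ := exists_add_pow_prime_eq hp.out u v
  have universal : (u + v) ^ (p - 1) • d (u + v) =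
      u ^ (p - 1) • d u + v ^ (p - 1) • d v + d (u * v * w) := by
    have hd := congrArg d hw
    have hfree : Module.Free P Ω[P⁄ℤ] := .of_basis (KaehlerDifferential.mvPolynomialBasis ℤ _)
    have hP : (p : P) ≠ 0 := Nat.cast_ne_zero.2 hp.out.ne_zero
    rw [mul_assoc, mul_assoc, ← mul_assoc u, ← nsmul_eq_mul, map_add, map_add, map_nsmul,
      d.leibniz_pow, d.leibniz_pow, d.leibniz_pow, ← smul_add, ← smul_add] at hd
    simp only [← Nat.cast_smul_eq_nsmul P] at hd
    exact smul_right_injective _ hP hd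
  let ev : P →ₐ[ℤ] R := MvPolynomial.aeval ![f, g]
  let : Algebra P R := ev.toAlgebra
  let : Module P M := Module.compHom M (ev : P →+* R)
  have : IsScalarTower P R M := ⟨fun a b m => mul_smul (ev a) b m⟩
  let δ : Ω[P⁄ℤ] →ₗ[P] M := ((D.restrictScalars ℤ).compAlgebraMap P).liftKaehlerDifferential
  have hδ (q : P) : δ (d q) = D (ev q) := Derivation.liftKaehlerDifferential_comp_D _ q
  have hsmul (q : P) (m : M) : q • m = ev q • m := rfl
  have hu : ev u = f := MvPolynomial.aeval_X _ _
  have hv : ev v = g := MvPolynomial.aeval_X _ _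
  refine ⟨ev (u * v * w), ?_⟩
  simpa only [map_add, map_smul, hδ, hsmul, map_pow, hu, hv] using congrArg δ universal

theorem cast_factorial_pred_eq_neg_one (p : ℕ) [Fact p.Prime] (R : Type*) [CommRing R]
    [CharP R p] : ((p - 1).factorial : R) = -1 := by
  simpa only [map_natCast, map_neg, map_one] using
    congrArg (ZMod.castHom dvd_rfl R) (ZMod.wilsons_lemma p)

theorem cast_descFactorial_pred_eq_zero (p : ℕ) [hp : Fact p.Prime] (R : Type*) [CommRing R]
    [CharP R p] {m : ℕ} (hm : ¬ p ∣ m + 1) : (m.descFactorial (p - 1) : R) = 0 := by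
  rw [CharP.cast_eq_zero_iff R p]
  have hdvd := Nat.factorial_dvd_descFactorial (m + 1) (p - 1 + 1)
  rw [Nat.succ_descFactorial_succ, Nat.sub_add_cancel hp.out.one_le] at hdvd
  exact (hp.out.dvd_mul.1 ((Nat.dvd_factorial hp.out.pos le_rfl).trans hdvd)).resolve_left hm

variable {p : ℕ} [hp : Fact p.Prime] {C R : Type*} [CommRing C] [CommRing R] [Algebra C R]
  [CharP R p] {D : Derivation C R R} {x : R}

theorem derivation_iterate_pred_pow_pred (hx : D x = 1) : D^[p - 1] (x ^ (p - 1)) = -1 := by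
  rw [derivation_iterate_pow_of_apply_eq_one D hx, Nat.descFactorial_self,
    cast_factorial_pred_eq_neg_one, Nat.sub_self, pow_zero, mul_one]

theorem derivation_iterate_pred_mem_range_algebraMap (hx : D x = 1)
    (hpow : x ^ p ∈ (algebraMap C R).range) {b : R} (hb : b ∈ Algebra.adjoin C {x}) :
    D^[p - 1] b ∈ (algebraMap C R).range := by
  rw [Algebra.adjoin_singleton_eq_range_aeval, AlgHom.mem_range] at hb
  obtain ⟨q, rfl⟩ := hb
  induction q using Polynomial.induction_on' with
  | add q r hq hr =>
    simp only [map_add, iterate_map_add]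
    exact add_mem hq hr
  | monomial m c =>
    rw [Polynomial.aeval_monomial, derivation_iterate_mul_of_apply_eq_zero D (D.map_algebraMap c),
      derivation_iterate_pow_of_apply_eq_one D hx]
    refine mul_mem ⟨c, rfl⟩ ?_
    by_cases hm : p ∣ m + 1
    · obtain ⟨r, hr⟩ := hm
      obtain ⟨s, rfl⟩ : ∃ s, r = s + 1 := Nat.exists_eq_succ_of_ne_zero (by rintro rfl; omega)
      have hexp : m - (p - 1) = p * s := by have := hp.out.one_le; rw [mul_add] at hr; omega
      rw [hexp, pow_mul]
      exact mul_mem (natCast_mem _ _) (pow_mem hpow _)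
    · rw [cast_descFactorial_pred_eq_zero p R hm, zero_mul]
      exact zero_mem _

theorem derivation_iterate_char_eq_zero (hx : D x = 1) (hpow : x ^ p ∈ (algebraMap C R).range)
    {b : R} (hb : b ∈ Algebra.adjoin C {x}) : D^[p] b = 0 := by
  obtain ⟨c, hc⟩ := derivation_iterate_pred_mem_range_algebraMap hx hpow hb
  rw [← Nat.sub_add_cancel hp.out.one_le, Function.iterate_succ_apply', ← hc, D.map_algebraMap]

-- By the theorem of Wilson, `b = -D ^ (p - 1) (b * x ^ (p - 1))`.
theorem mem_range_algebraMap_of_derivation_apply_eq_zero (hx : D x = 1)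
    (hpow : x ^ p ∈ (algebraMap C R).range) {b : R} (hb : b ∈ Algebra.adjoin C {x})
    (hDb : D b = 0) : b ∈ (algebraMap C R).range := by
  have hmem : b * x ^ (p - 1) ∈ Algebra.adjoin C {x} :=
    mul_mem hb (pow_mem (Algebra.self_mem_adjoin_singleton C x) _)
  have hneg : D^[p - 1] (b * x ^ (p - 1)) = -b := by
    rw [derivation_iterate_mul_of_apply_eq_zero D hDb, derivation_iterate_pred_pow_pred hx,
      mul_neg_one]
  exact neg_mem_iff.1 (hneg ▸ derivation_iterate_pred_mem_range_algebraMap hx hpow hmem)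

omit hp in
theorem derivation_pow_char_eq_zero (D : Derivation C R R) (a : R) : D (a ^ p) = 0 := by
  rw [D.leibniz_pow, ← Nat.cast_smul_eq_nsmul R, CharP.cast_eq_zero, zero_smul]

-- The identity is stable under sums and products in `f`, as `D ^ p = 0` and `D` kills `p`-th
-- powers, so it suffices to check it on the generator `x`.
theorem derivation_iterate_pred_pow_pred_mul_apply (hx : D x = 1)
    (hpow : x ^ p ∈ (algebraMap C R).range) (htop : Algebra.adjoin C {x} = ⊤) (f : R) :
    D^[p - 1] (f ^ (p - 1) * D f) = -(D f) ^ p := by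
  have hp1 := Nat.sub_add_cancel hp.out.one_le
  have hf : f ∈ Algebra.adjoin C {x} := htop ▸ Algebra.mem_top
  induction hf using Algebra.adjoin_induction with
  | mem y hy =>
    rw [Set.mem_singleton_iff.1 hy, hx, mul_one, one_pow, derivation_iterate_pred_pow_pred hx]
  | algebraMap c =>
    rw [D.map_algebraMap, mul_zero, iterate_map_zero, zero_pow hp.out.ne_zero, neg_zero]
  | add a b _ _ ha hb =>
    obtain ⟨h, hh⟩ := exists_pow_pred_smul_derivation_add_eq p D a b
    simp only [smul_eq_mul] at hh
    rw [hh, iterate_map_add, iterate_map_add, ha, hb, ← Function.iterate_succ_apply,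
      Nat.succ_eq_add_one, hp1,
      derivation_iterate_char_eq_zero hx hpow (htop ▸ Algebra.mem_top), map_add, add_pow_char]
    ring
  | mul a b _ _ ha hb =>
    have hsplit : (a * b) ^ (p - 1) * D (a * b) =
        a ^ p * (b ^ (p - 1) * D b) + b ^ p * (a ^ (p - 1) * D a) := by
      rw [D.leibniz, ← hp1, Nat.add_sub_cancel]
      simp only [smul_eq_mul]
      ring
    rw [hsplit, iterate_map_add,
      derivation_iterate_mul_of_apply_eq_zero D (derivation_pow_char_eq_zero D a),
      derivation_iterate_mul_of_apply_eq_zero D (derivation_pow_char_eq_zero D b), ha, hb,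
      D.leibniz, add_pow_char]
    simp only [smul_eq_mul, mul_pow]
    ring

end OneVariable

section PBasis

/-- A derivation that kills the image of `C`, regarded as a `C`-linear derivation. -/
def derivationOver {A R M : Type*} [CommRing A] [CommRing R] [Algebra A R] [AddCommGroup M]
    [Module A M] [Module R M] (C : Type*) [CommRing C] [Algebra C R] [Module C M]
    [IsScalarTower C R M] (D : Derivation A R M) (hD : ∀ c : C, D (algebraMap C R c) = 0) :
    Derivation C R M :=
  .mk'
    { toFun := D
      map_add' := map_add D
      map_smul' := fun c b => by
        rw [Algebra.smul_def, D.leibniz, hD, smul_zero, add_zero, algebraMap_smul,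
          RingHom.id_apply] }
    D.leibniz

/-- A system of generators `x` of a `K`-algebra `R` whose `p`-th powers come from `K`, together
with `K`-derivations `D` of `R` dual to it. In characteristic `p` this makes `x` a `p`-basis of
`R` over the image of `K`. -/
structure IsPBasis (p : ℕ) (K : Type*) {R ι : Type*} [CommRing K] [CommRing R] [Algebra K R]
    (x : ι → R) (D : ι → Derivation K R R) : Prop where
  apply_self : ∀ i, D i (x i) = 1
  apply_of_ne : ∀ i j, i ≠ j → D i (x j) = 0
  pow_mem : ∀ i, x i ^ p ∈ (algebraMap K R).range
  adjoin_eq_top : Algebra.adjoin K (Set.range x) = ⊤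

namespace IsPBasis

variable {p : ℕ} {K R ι : Type*} [CommRing K] [CommRing R] [Algebra K R]
  {x : ι → R} {D : ι → Derivation K R R} (h : IsPBasis p K x D)

include h

theorem apply_eq_zero_of_mem_adjoin {i : ι} {s : Set ι} (hi : i ∉ s) {c : R}
    (hc : c ∈ Algebra.adjoin K (x '' s)) : D i c = 0 := by
  have heq : Set.EqOn (D i) (0 : Derivation K R R) (x '' s) := by
    rintro _ ⟨j, hj, rfl⟩
    exact h.apply_of_ne i j (ne_of_mem_of_not_mem hj hi).symm
  exact Derivation.eqOn_adjoin heq hc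

theorem pow_mem_range_adjoin (i : ι) (s : Set R) :
    x i ^ p ∈ (algebraMap (Algebra.adjoin K s) R).range := by
  obtain ⟨c, hc⟩ := h.pow_mem i
  exact ⟨algebraMap K _ c, hc⟩

omit h in
theorem mem_adjoin_singleton_of_mem_adjoin_insert {i : ι} {s : Set ι} {b : R}
    (hb : b ∈ Algebra.adjoin K (x '' insert i s)) :
    b ∈ Algebra.adjoin (Algebra.adjoin K (x '' s)) {x i} := by
  rw [Set.image_insert_eq, Set.insert_eq, Set.union_comm,
    Algebra.adjoin_union_eq_adjoin_adjoin] at hb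
  exact hb

variable [hp : Fact p.Prime] [CharP R p]

theorem mem_range_algebraMap_of_forall_apply_eq_zero [Finite ι] {b : R} (hb : ∀ i, D i b = 0) :
    b ∈ (algebraMap K R).range := by
  suffices H : ∀ s : Set ι, s.Finite → b ∈ Algebra.adjoin K (x '' s) →
      b ∈ (algebraMap K R).range from
    H Set.univ Set.finite_univ (by rw [Set.image_univ, h.adjoin_eq_top]; trivial)
  intro s hs
  induction s, hs using Set.Finite.induction_on with
  | empty =>
    rw [Set.image_empty, Algebra.adjoin_empty]
    exact Algebra.mem_bot.1
  | @insert i s hi _ ih =>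
    intro hmem
    let C := Algebra.adjoin K (x '' s)
    let δ : Derivation C R R := derivationOver C (D i) fun c =>
      h.apply_eq_zero_of_mem_adjoin hi c.2
    obtain ⟨c, rfl⟩ := mem_range_algebraMap_of_derivation_apply_eq_zero (D := δ) (h.apply_self i)
      (h.pow_mem_range_adjoin i _) (mem_adjoin_singleton_of_mem_adjoin_insert hmem) (hb i)
    exact ih c.2

omit hp [CharP R p] in
theorem adjoin_singleton_eq_top (i : ι) :
    Algebra.adjoin (Algebra.adjoin K (x '' {i}ᶜ)) {x i} = ⊤ := by
  refine eq_top_iff.2 fun b _ => mem_adjoin_singleton_of_mem_adjoin_insert ?_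
  rw [← Set.union_singleton, Set.compl_union_self, Set.image_univ, h.adjoin_eq_top]
  trivial

theorem iterate_char_apply (i : ι) (b : R) : (D i)^[p] b = 0 :=
  derivation_iterate_char_eq_zero
    (D := derivationOver (Algebra.adjoin K (x '' {i}ᶜ)) (D i) fun c =>
      h.apply_eq_zero_of_mem_adjoin (by simp) c.2)
    (h.apply_self i) (h.pow_mem_range_adjoin i _) (h.adjoin_singleton_eq_top i ▸ Algebra.mem_top)

theorem iterate_pred_pow_pred_mul_apply (i : ι) (f : R) :
    (D i)^[p - 1] (f ^ (p - 1) * D i f) = -(D i f) ^ p :=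
  derivation_iterate_pred_pow_pred_mul_apply
    (D := derivationOver (Algebra.adjoin K (x '' {i}ᶜ)) (D i) fun c =>
      h.apply_eq_zero_of_mem_adjoin (by simp) c.2)
    (h.apply_self i) (h.pow_mem_range_adjoin i _) (h.adjoin_singleton_eq_top i) f

-- Apply `D ^ (p - 1)`: it kills the exact right-hand side, and acts on the left-hand side as
-- the Cartier operator.
theorem sum_pow_mul_eq_zero_of_exact [IsReduced R] {N : ℕ} {u : ℕ → R} {z : R} {i : ι}
    (hu : ∑ m ∈ Finset.range N, u m ^ (p ^ (m + 1) - 1) * D i (u m) = D i z) :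
    ∑ m ∈ Finset.range N, u m ^ (p ^ m - 1) * D i (u m) = 0 := by
  have hexp (m : ℕ) : p ^ (m + 1) - 1 = (p ^ m - 1) * p + (p - 1) := by
    have hp1 := hp.out.one_le
    have hpm : p ≤ p ^ m * p := Nat.le_mul_of_pos_left p (pow_pos hp.out.pos m)
    rw [Nat.sub_mul, one_mul, pow_succ]
    omega
  have hterm (m : ℕ) : (D i)^[p - 1] (u m ^ (p ^ (m + 1) - 1) * D i (u m)) =
      -(u m ^ (p ^ m - 1) * D i (u m)) ^ p := by
    rw [hexp, pow_add, pow_mul, mul_assoc,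
      derivation_iterate_mul_of_apply_eq_zero _ (derivation_pow_char_eq_zero _ _),
      h.iterate_pred_pow_pred_mul_apply, mul_pow, mul_neg]
  have hcartier := congrArg (D i)^[p - 1] hu
  rw [derivation_iterate_map_sum, ← Function.iterate_succ_apply, Nat.succ_eq_add_one,
    Nat.sub_add_cancel hp.out.one_le, h.iterate_char_apply] at hcartier
  simp only [hterm, Finset.sum_neg_distrib, neg_eq_zero] at hcartier
  rwa [← sum_pow_char, pow_eq_zero_iff hp.out.ne_zero] at hcartier

theorem apply_eq_zero_of_sum_pow_mul_eq_zero [IsReduced R] {N : ℕ} {u : ℕ → R}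
    (hu : ∀ i, ∑ m ∈ Finset.range N, u m ^ (p ^ m - 1) * D i (u m) = 0) :
    ∀ m < N, ∀ i, D i (u m) = 0 := by
  induction N generalizing u with
  | zero => intro m hm; omega
  | succ N ih =>
    have hexact (i : ι) : ∑ m ∈ Finset.range N, u (m + 1) ^ (p ^ (m + 1) - 1) * D i (u (m + 1)) =
        D i (-u 0) := by
      have hi := hu i
      rw [Finset.sum_range_succ', pow_zero, Nat.sub_self, pow_zero, one_mul] at hi
      rw [map_neg, eq_neg_of_add_eq_zero_left hi]
    have hsucc := ih fun i => h.sum_pow_mul_eq_zero_of_exact (hexact i)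
    rintro (_ | m) hm i
    · have hi := hexact i
      rw [Finset.sum_eq_zero fun m hm => by rw [hsucc m (Finset.mem_range.1 hm), mul_zero],
        map_neg, zero_eq_neg] at hi
      exact hi
    · exact hsucc m (by omega) i

end IsPBasis

end PBasis

section GhostComponents

variable {p : ℕ} [hp : Fact p.Prime] {B : Type*} [CommRing B]

theorem ghostComponent_eq_sum (m : ℕ) (z : WittVector p B) :
    WittVector.ghostComponent m z =
      ∑ j ∈ Finset.range (m + 1), (p : B) ^ j * z.coeff j ^ p ^ (m - j) := by
  rw [WittVector.ghostComponent_apply, aeval_wittPolynomial]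

omit hp in
theorem pow_succ_dvd_pow_mul_pow_sub {a b : B} (hab : (p : B) ∣ a - b) {j m : ℕ} (hj : j ≤ m) :
    (p : B) ^ (m + 1) ∣ (p : B) ^ j * a ^ p ^ (m - j) - (p : B) ^ j * b ^ p ^ (m - j) := by
  have hm : m + 1 = j + (m - j + 1) := by omega
  rw [hm, pow_add, ← mul_sub]
  exact mul_dvd_mul_left _ (dvd_sub_pow_of_dvd_sub hab (m - j))

theorem pow_succ_dvd_ghostComponent_sub {m N : ℕ} (hm : m ≤ N) {z : WittVector p B}
    (hz : ∀ j < m, (p : B) ∣ z.coeff j) :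
    (p : B) ^ (m + 1) ∣ WittVector.ghostComponent N z - (p : B) ^ m * z.coeff m ^ p ^ (N - m) := by
  rw [ghostComponent_eq_sum, ← Finset.add_sum_erase _ _ (Finset.mem_range_succ_iff.2 hm),
    add_sub_cancel_left]
  refine Finset.dvd_sum fun j hj => ?_
  obtain ⟨hjm, -⟩ := Finset.mem_erase.1 hj
  rcases hjm.lt_or_gt with hlt | hgt
  · have hdvd := pow_succ_dvd_pow_mul_pow_sub (p := p) (a := z.coeff j) (b := 0)
      (by rw [sub_zero]; exact hz j hlt) (hlt.le.trans hm)
    rw [zero_pow (pow_ne_zero _ hp.out.ne_zero), mul_zero, sub_zero] at hdvd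
    exact (pow_dvd_pow _ (by omega)).trans hdvd
  · exact (pow_dvd_pow _ hgt).mul_right _

theorem derivation_ghostComponent {A M : Type*} [CommRing A] [Algebra A B] [AddCommGroup M]
    [Module A M] [Module B M] (D : Derivation A B M) (m : ℕ) (z : WittVector p B) :
    D (WittVector.ghostComponent m z) = (p : B) ^ m •
      ∑ j ∈ Finset.range (m + 1), z.coeff j ^ (p ^ (m - j) - 1) • D (z.coeff j) := by
  rw [ghostComponent_eq_sum, map_sum, Finset.smul_sum]
  refine Finset.sum_congr rfl fun j hj => ?_
  have hpow : (p : B) ^ m = (p : B) ^ j * (p ^ (m - j) : ℕ) := by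
    rw [Nat.cast_pow, ← pow_add, Nat.add_sub_cancel' (Finset.mem_range_succ_iff.1 hj)]
  rw [D.leibniz, ← Nat.cast_pow, D.map_natCast, smul_zero, add_zero, D.leibniz_pow,
    ← Nat.cast_smul_eq_nsmul B, smul_smul, hpow, Nat.cast_pow]

end GhostComponents

/-- `π : B → R` is the reduction modulo `p` of a ring `B` that is flat over `ℤ / p ^ n`; flatness
is expressed by the condition that an element killed by `p ^ j`, `j < n`, is divisible by `p`. -/
structure IsFlatThickening (p n : ℕ) {B R : Type*} [CommRing B] [CommRing R] (π : B →+* R) :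
    Prop where
  pow_eq_zero : (p : B) ^ n = 0
  dvd_of_pow_mul_eq_zero : ∀ j < n, ∀ b : B, (p : B) ^ j * b = 0 → (p : B) ∣ b
  surjective : Function.Surjective π
  map_eq_zero_iff : ∀ b, π b = 0 ↔ (p : B) ∣ b

namespace IsFlatThickening

variable {p n : ℕ} {B R : Type*} [CommRing B] [CommRing R] {π : B →+* R}
  (h : IsFlatThickening p n π)

include h

theorem ker_le_nilradical : RingHom.ker π ≤ nilradical B := fun b hb => by
  obtain ⟨c, rfl⟩ := (h.map_eq_zero_iff b).1 hb
  exact ⟨n, (mul_pow _ _ n).trans (by rw [h.pow_eq_zero, zero_mul])⟩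

theorem subsingleton [Subsingleton R] : Subsingleton B := by
  obtain ⟨c, hc⟩ := (h.map_eq_zero_iff 1).1 (Subsingleton.elim _ _)
  refine subsingleton_of_zero_eq_one ?_
  rw [← one_pow n, hc, mul_pow, h.pow_eq_zero, zero_mul]

theorem dvd_sub_of_map_eq {a b : B} (hab : π a = π b) : (p : B) ∣ a - b :=
  (h.map_eq_zero_iff _).1 (by rw [map_sub, hab, sub_self])

variable [hp : Fact p.Prime]

theorem truncate_comp_map_surjective :
    Function.Surjective ((WittVector.truncate n).comp (WittVector.map (p := p) π)) :=
  (WittVector.truncate_surjective p n R).comp (WittVector.map_surjective π h.surjective)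

omit h in
theorem coeff_truncate_comp_map (z : WittVector p B) (j : Fin n) :
    ((WittVector.truncate n).comp (WittVector.map π) z).coeff j = π (z.coeff j) := by
  rw [RingHom.comp_apply, WittVector.coeff_truncate, WittVector.map_coeff]

theorem ker_truncate_comp_map_le :
    RingHom.ker ((WittVector.truncate n).comp (WittVector.map (p := p) π)) ≤
      RingHom.ker (WittVector.ghostComponent (p := p) (R := B) n) := by
  intro z hz
  have hcoeff (j : ℕ) (hj : j < n) : (p : B) ∣ z.coeff j := by
    rw [← h.map_eq_zero_iff, ← coeff_truncate_comp_map (n := n) z ⟨j, hj⟩, hz]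
    exact TruncatedWittVector.coeff_zero p n R _
  have hdvd := pow_succ_dvd_ghostComponent_sub le_rfl hcoeff
  rw [pow_succ, h.pow_eq_zero, zero_mul, zero_mul, sub_zero, zero_dvd_iff] at hdvd
  exact hdvd

/-- The ring homomorphism `W_n(R) → B` induced by the ghost component `w_n : W(B) → B`. -/
noncomputable def ghostHom : TruncatedWittVector p n R →+* B :=
  ((WittVector.truncate n).comp (WittVector.map π)).liftOfSurjective
    h.truncate_comp_map_surjective ⟨WittVector.ghostComponent n, h.ker_truncate_comp_map_le⟩

theorem ghostHom_truncate_map (z : WittVector p B) :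
    h.ghostHom (WittVector.truncate n (WittVector.map π z)) = WittVector.ghostComponent n z :=
  RingHom.liftOfSurjective_comp_apply _ h.truncate_comp_map_surjective
    ⟨WittVector.ghostComponent n, h.ker_truncate_comp_map_le⟩ z

theorem exists_truncate_map_eq (x : TruncatedWittVector p n R) :
    ∃ z : WittVector p B, WittVector.truncate n (WittVector.map π z) = x :=
  h.truncate_comp_map_surjective x

theorem range_ghostHom_eq_range_ghostComponent :
    Set.range h.ghostHom = Set.range (WittVector.ghostComponent (p := p) (R := B) n) := by
  refine Set.ext fun b => ⟨?_, ?_⟩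
  · rintro ⟨x, rfl⟩
    obtain ⟨z, rfl⟩ := h.exists_truncate_map_eq x
    exact ⟨z, (h.ghostHom_truncate_map z).symm⟩
  · rintro ⟨z, rfl⟩
    exact ⟨_, h.ghostHom_truncate_map z⟩

theorem ghostHom_apply {x : TruncatedWittVector p n R} {y : Fin n → B}
    (hy : ∀ j, π (y j) = x.coeff j) :
    h.ghostHom x = ∑ j : Fin n, (p : B) ^ (j : ℕ) * y j ^ p ^ (n - (j : ℕ)) := by
  let z : WittVector p B := .mk p fun j => if hj : j < n then y ⟨j, hj⟩ else 0
  have hzy (j : Fin n) : z.coeff j = y j := dif_pos j.2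
  have hz : WittVector.truncate n (WittVector.map π z) = x := by
    ext j
    rw [← hy, ← hzy]
    exact coeff_truncate_comp_map z j
  rw [← hz, h.ghostHom_truncate_map, ghostComponent_eq_sum, Finset.sum_range_succ, h.pow_eq_zero,
    zero_mul, add_zero, Finset.sum_range]
  simp only [hzy]

theorem map_ghostHom {B' R' : Type*} [CommRing B'] [CommRing R'] {π' : B' →+* R'}
    (h' : IsFlatThickening p n π') {g : B →+* B'} {gbar : R →+* R'}
    (hg : π'.comp g = gbar.comp π) (x : TruncatedWittVector p n R) :
    g (h.ghostHom x) = h'.ghostHom (TruncatedWittVector.map gbar x) := by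
  choose y hy using fun j => h.surjective (x.coeff j)
  rw [h.ghostHom_apply hy, h'.ghostHom_apply (y := fun j => g (y j)) fun j => ?_]
  · simp only [map_sum, map_mul, map_pow, map_natCast]
  · rw [TruncatedWittVector.coeff_map, ← hy]
    exact RingHom.congr_fun hg (y j)

theorem ghostHom_injective [IsReduced R] : Function.Injective h.ghostHom := by
  refine (injective_iff_map_eq_zero _).2 fun x hx => ?_
  obtain ⟨z, rfl⟩ := h.exists_truncate_map_eq x
  rw [h.ghostHom_truncate_map] at hx
  have hcoeff (m : ℕ) : m < n → π (z.coeff m) = 0 := by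
    induction m using Nat.strong_induction_on with
    | _ m ih =>
      intro hm
      obtain ⟨t, ht⟩ := pow_succ_dvd_ghostComponent_sub hm.le fun j hj =>
        (h.map_eq_zero_iff _).1 (ih j hj (hj.trans hm))
      have hzero : (p : B) ^ m * (z.coeff m ^ p ^ (n - m) + p * t) = 0 := by
        rw [mul_add, ← mul_assoc, ← pow_succ, ← ht, hx]
        ring
      have hdvd := h.dvd_of_pow_mul_eq_zero m hm _ hzero
      rw [dvd_add_left (dvd_mul_right _ _), ← h.map_eq_zero_iff, map_pow] at hdvd
      exact eq_zero_of_pow_eq_zero hdvd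
  ext j
  rw [← RingHom.comp_apply, coeff_truncate_comp_map, hcoeff j j.2]
  exact (TruncatedWittVector.coeff_zero p n R j).symm

variable {A : Type*} [CommRing A] [Algebra A B]

theorem apply_ghostHom {M : Type*} [AddCommGroup M] [Module A M] [Module B M]
    (D : Derivation A B M) (x : TruncatedWittVector p n R) : D (h.ghostHom x) = 0 := by
  obtain ⟨z, rfl⟩ := h.exists_truncate_map_eq x
  rw [h.ghostHom_truncate_map, derivation_ghostComponent, h.pow_eq_zero, zero_smul]

variable [CharP R p] {ι : Type*} {x : ι → R} {D : ι → Derivation (frobenius R p).range R R}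
  (hD : IsPBasis p (frobenius R p).range x D)

include hD

theorem exists_dvd_sub_pow [Finite ι] {b : B} (hb : ∀ i, D i (π b) = 0) :
    ∃ w, (p : B) ∣ b - w ^ p := by
  obtain ⟨⟨_, a, rfl⟩, ha⟩ := hD.mem_range_algebraMap_of_forall_apply_eq_zero hb
  obtain ⟨w, rfl⟩ := h.surjective a
  exact ⟨w, h.dvd_sub_of_map_eq (by rw [map_pow]; exact ha.symm)⟩

variable [IsReduced R] {d : ι → Derivation A B B} (hd : ∀ i b, π (d i b) = D i (π b))

include hd

theorem apply_map_coeff_eq_zero {m : ℕ} (hm : m < n) {z : WittVector p B}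
    (hz : ∀ i, d i (WittVector.ghostComponent m z) = 0) :
    ∀ j ≤ m, ∀ i, D i (π (z.coeff j)) = 0 := by
  have hsum (i : ι) : ∑ l ∈ Finset.range (m + 1),
      π (z.coeff (m - l)) ^ (p ^ l - 1) * D i (π (z.coeff (m - l))) = 0 := by
    have hi := hz i
    rw [derivation_ghostComponent, smul_eq_mul] at hi
    have hmod := (h.map_eq_zero_iff _).2 (h.dvd_of_pow_mul_eq_zero m hm _ hi)
    rw [← Finset.sum_range_reflect, map_sum] at hmod
    rw [← hmod]
    refine Finset.sum_congr rfl fun l hl => ?_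
    have hl : m + 1 - 1 - l = m - l ∧ m - (m - l) = l := by
      have := Finset.mem_range.1 hl
      omega
    rw [hl.1, hl.2, smul_eq_mul, map_mul, map_pow, hd]
  intro j hj i
  have := hD.apply_eq_zero_of_sum_pow_mul_eq_zero hsum (m - j) (by omega) i
  rwa [Nat.sub_sub_self hj] at this

theorem exists_ghostComponent_succ_eq [Finite ι] {m : ℕ} (hm : m < n) {z : WittVector p B}
    (hz : ∀ i, d i (WittVector.ghostComponent m z) = 0) :
    ∃ w : WittVector p B,
      WittVector.ghostComponent (m + 1) w = WittVector.ghostComponent m z := by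
  choose! w hw using fun j hj => h.exists_dvd_sub_pow hD
    (h.apply_map_coeff_eq_zero hD hd hm hz j hj)
  have hdvd : (p : B) ^ (m + 1) ∣ WittVector.ghostComponent m z -
      ∑ j ∈ Finset.range (m + 1), (p : B) ^ j * w j ^ p ^ (m + 1 - j) := by
    rw [ghostComponent_eq_sum, ← Finset.sum_sub_distrib]
    refine Finset.dvd_sum fun j hj => ?_
    have hj := Finset.mem_range_succ_iff.1 hj
    rw [Nat.succ_sub hj, pow_succ' p, pow_mul]
    exact pow_succ_dvd_pow_mul_pow_sub (hw j hj) hj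
  obtain ⟨t, ht⟩ := hdvd
  refine ⟨.mk p fun j => if j ≤ m then w j else t, ?_⟩
  rw [sub_eq_iff_eq_add'.1 ht, ghostComponent_eq_sum, Finset.sum_range_succ]
  congr 1
  · refine Finset.sum_congr rfl fun j hj => ?_
    rw [WittVector.coeff_mk, if_pos (Finset.mem_range_succ_iff.1 hj)]
  · rw [WittVector.coeff_mk, if_neg (by omega), Nat.sub_self, pow_zero, pow_one]

theorem range_ghostHom [Finite ι] : Set.range h.ghostHom = {b | ∀ i, d i b = 0} := by
  refine Set.ext fun b => ⟨?_, fun hb => ?_⟩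
  · rintro ⟨x, rfl⟩ i
    exact h.apply_ghostHom (d i) x
  rw [h.range_ghostHom_eq_range_ghostComponent]
  suffices H : ∀ m ≤ n, b ∈ Set.range (WittVector.ghostComponent (p := p) m) from H n le_rfl
  intro m
  induction m with
  | zero => exact fun _ => ⟨.mk p fun _ => b, by simp [ghostComponent_eq_sum]⟩
  | succ m ih =>
    intro hm
    obtain ⟨z, rfl⟩ := ih (by omega)
    exact h.exists_ghostComponent_succ_eq hD hd hm hb

end IsFlatThickening

section TruncatedWitt

open TruncatedWittVector

variable (p : ℕ) [hp : Fact p.Prime] (n : ℕ) (k : Type*) [CommRing k] [CharP k p] [PerfectRing k p]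

variable {p n k} in
theorem truncate_eq_zero_iff_pow_dvd (z : WittVector p k) :
    WittVector.truncate n z = 0 ↔ (p : WittVector p k) ^ n ∣ z := by
  rw [← Ideal.mem_span_singleton, WittVector.mem_span_p_pow_iff_le_coeff_eq_zero,
    ← RingHom.mem_ker, WittVector.mem_ker_truncate]

omit [CharP k p] [PerfectRing k p] in
variable {p n k} in
theorem firstCoeff_truncate [NeZero n] (z : WittVector p k) :
    firstCoeff (WittVector.truncate n z) = z.coeff 0 :=
  WittVector.coeff_truncate z 0

theorem isFlatThickening_firstCoeff [NeZero n] :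
    IsFlatThickening p n (firstCoeff : TruncatedWittVector p n k →+* k) where
  pow_eq_zero := by
    rw [← map_natCast (WittVector.truncate n), ← map_pow, truncate_eq_zero_iff_pow_dvd]
  dvd_of_pow_mul_eq_zero j hj b hb := by
    obtain ⟨z, rfl⟩ := WittVector.truncate_surjective p n k b
    rw [← map_natCast (WittVector.truncate n), ← map_pow, ← map_mul,
      truncate_eq_zero_iff_pow_dvd] at hb
    have hp_mem : (p : WittVector p k) ∈ nonZeroDivisors (WittVector p k) :=
      mem_nonZeroDivisors_iff_right.2 WittVector.eq_zero_of_p_mul_eq_zero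
    have hdvd : (p : WittVector p k) ∣ z := by
      rw [← Nat.add_sub_cancel' hj, Nat.succ_eq_add_one, pow_add, pow_succ, mul_assoc,
        dvd_cancel_left_mem_nonZeroDivisors (pow_mem hp_mem j)] at hb
      exact (dvd_mul_right _ _).trans hb
    rw [← map_natCast (WittVector.truncate n)]
    exact map_dvd _ hdvd
  surjective a := ⟨mk p fun _ => a, coeff_mk (p := p) (fun _ => a) (0 : Fin n)⟩
  map_eq_zero_iff b := by
    obtain ⟨z, rfl⟩ := WittVector.truncate_surjective p n k b
    rw [← map_natCast (WittVector.truncate n), firstCoeff_truncate,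
      ← WittVector.mem_span_p_iff_coeff_zero_eq_zero, Ideal.mem_span_singleton]
    refine ⟨map_dvd _, ?_⟩
    rintro ⟨w, hw⟩
    obtain ⟨w, rfl⟩ := WittVector.truncate_surjective p n k w
    rw [← Ideal.mem_span_singleton, WittVector.mem_span_p_iff_coeff_zero_eq_zero,
      ← firstCoeff_truncate (n := n), hw, ← map_mul, firstCoeff_truncate, mul_comm,
      WittVector.mul_charP_coeff_zero]

omit [PerfectRing k p] in
theorem iterate_frobeniusMap_truncate_teichmuller (m : ℕ) (c : k) :
    (frobeniusMap p n k)^[m] (WittVector.truncate n (WittVector.teichmuller p c)) =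
      WittVector.truncate n (WittVector.teichmuller p c) ^ p ^ m := by
  induction m with
  | zero => rw [Function.iterate_zero_apply, pow_zero, pow_one]
  | succ m ih =>
    rw [Function.iterate_succ_apply', ih, map_pow, frobeniusMap_truncate,
      WittVector.frobenius_eq_map_frobenius, WittVector.map_teichmuller, frobenius_def, map_pow,
      map_pow, ← pow_mul, pow_succ']

-- Two ring homomorphisms from `W(k)` to a ring in which `p` is nilpotent agree if they agree on
-- Teichmüller representatives.
theorem ghostHom_firstCoeff [NeZero n] (a : TruncatedWittVector p n k) :
    (isFlatThickening_firstCoeff p n k).ghostHom a = (frobeniusMap p n k)^[n] a := by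
  obtain ⟨z, rfl⟩ := WittVector.truncate_surjective p n k a
  have hnil : IsNilpotent (p : TruncatedWittVector p n k) :=
    ⟨n, (isFlatThickening_firstCoeff p n k).pow_eq_zero⟩
  rw [← RingHom.coe_pow]
  refine RingHom.congr_fun (WittVector.eq_of_apply_teichmuller_eq
    ((isFlatThickening_firstCoeff p n k).ghostHom.comp (WittVector.truncate n))
    ((frobeniusMap p n k ^ n).comp (WittVector.truncate n)) hnil fun c => ?_) z
  have hfirst : firstCoeff (WittVector.truncate n (WittVector.teichmuller p c)) = c :=
    (firstCoeff_truncate _).trans (WittVector.teichmuller_coeff_zero p c)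
  rw [RingHom.comp_apply, RingHom.comp_apply, RingHom.coe_pow,
    iterate_frobeniusMap_truncate_teichmuller]
  conv_lhs => rw [← hfirst, ← WittVector.map_teichmuller]
  rw [IsFlatThickening.ghostHom_truncate_map, WittVector.ghostComponent_teichmuller]

end TruncatedWitt

section BaseChange

variable {p n : ℕ} {A k B R : Type*} [CommRing A] [CommRing k] [CommRing B] [CommRing R]
  [Algebra A k] [Algebra A B] [Algebra A R] [Algebra k R] [Algebra B R] [IsScalarTower A k R]
  [IsScalarTower A B R]

-- The equational criterion for flatness, applied to the relation `s • b = 0`.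
theorem dvd_of_mul_eq_zero_of_flat [Module.Flat A B] {s t : A}
    (hst : ∀ a, s * a = 0 → t ∣ a) {b : B} (hb : algebraMap A B s * b = 0) :
    algebraMap A B t ∣ b := by
  have hrel : ∑ i : Unit, (fun _ => s) i • (fun _ => b) i = 0 := by
    rw [Fintype.sum_unique, Algebra.smul_def, hb]
  obtain ⟨_, a, y, hy, ha⟩ := Module.Flat.isTrivialRelation_of_sum_smul_eq_zero
    (R := A) (M := B) hrel
  rw [show b = ∑ l, a () l • y l from hy ()]
  refine Finset.dvd_sum fun l _ => ?_
  have hal := ha l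
  rw [Fintype.sum_unique] at hal
  rw [Algebra.smul_def]
  exact (map_dvd (algebraMap A B) (hst _ hal)).mul_right _

variable (A k) in
theorem surjective_algebraMap_of_isPushout [Algebra.IsPushout A k B R]
    (h : Function.Surjective (algebraMap A k)) : Function.Surjective (algebraMap B R) := by
  intro r
  obtain ⟨t, rfl⟩ := (Algebra.IsPushout.equiv A k B R).surjective r
  induction t using TensorProduct.induction_on with
  | zero => exact ⟨0, by rw [map_zero, map_zero]⟩
  | add a b ha hb =>
    obtain ⟨a', ha⟩ := ha
    obtain ⟨b', hb⟩ := hb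
    exact ⟨a' + b', by rw [map_add, map_add, ha, hb]⟩
  | tmul c b =>
    obtain ⟨a, rfl⟩ := h c
    refine ⟨algebraMap A B a * b, ?_⟩
    rw [Algebra.IsPushout.equiv_tmul, map_mul, ← IsScalarTower.algebraMap_apply,
      ← IsScalarTower.algebraMap_apply]

variable (A k) in
theorem ker_algebraMap_le_map_of_isPushout [Algebra.IsPushout A k B R]
    (h : Function.Surjective (algebraMap A k)) :
    RingHom.ker (algebraMap B R) ≤ (RingHom.ker (algebraMap A k)).map (algebraMap A B) := by
  intro b hb
  set I := (RingHom.ker (algebraMap A k)).map (algebraMap A B)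
  have hker (a : A) (ha : a ∈ RingHom.ker (Algebra.ofId A k)) : Algebra.ofId A (B ⧸ I) a = 0 :=
    Ideal.Quotient.eq_zero_iff_mem.2 (Ideal.mem_map_of_mem _ ha)
  let g : k →ₐ[A] B ⧸ I := (Ideal.Quotient.liftₐ _ (Algebra.ofId A _) hker).comp
    (Ideal.quotientKerAlgEquivOfSurjective (f := Algebra.ofId A k) h).symm
  have hdesc := Algebra.pushoutDesc_right R g (Ideal.Quotient.mkₐ A I)
    (fun _ _ => Commute.all _ _) b
  rw [RingHom.mem_ker.1 hb, map_zero] at hdesc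
  exact Ideal.Quotient.eq_zero_iff_mem.1 hdesc.symm

theorem IsFlatThickening.baseChange [Algebra.IsPushout A k B R] [Module.Flat A B]
    (h : IsFlatThickening p n (algebraMap A k)) : IsFlatThickening p n (algebraMap B R) where
  pow_eq_zero := by
    rw [← map_natCast (algebraMap A B), ← map_pow, h.pow_eq_zero, map_zero]
  dvd_of_pow_mul_eq_zero j hj b hb := by
    rw [← map_natCast (algebraMap A B), ← map_pow] at hb
    rw [← map_natCast (algebraMap A B)]
    exact dvd_of_mul_eq_zero_of_flat (h.dvd_of_pow_mul_eq_zero j hj) hb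
  surjective := surjective_algebraMap_of_isPushout A k h.surjective
  map_eq_zero_iff b := by
    refine ⟨fun hb => ?_, ?_⟩
    · have hker : RingHom.ker (algebraMap A k) = Ideal.span {(p : A)} :=
        Ideal.ext fun a => (h.map_eq_zero_iff a).trans Ideal.mem_span_singleton.symm
      have hmem := ker_algebraMap_le_map_of_isPushout A k h.surjective (RingHom.mem_ker.2 hb)
      rwa [hker, Ideal.map_span, Set.image_singleton, map_natCast, Ideal.mem_span_singleton]
        at hmem
    · rintro ⟨c, rfl⟩
      rw [map_mul, map_natCast, ← map_natCast (algebraMap k R), ← map_natCast (algebraMap A k),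
        (h.map_eq_zero_iff _).2 dvd_rfl, map_zero, zero_mul]

end BaseChange

section Reduced

open scoped TensorProduct

theorem charP_of_algebra (p : ℕ) [Fact p.Prime] (K : Type*) {T : Type*} [CommRing K] [CommRing T]
    [Algebra K T] [CharP K p] [Nontrivial T] : CharP T p :=
  (CharP.charP_iff_prime_eq_zero Fact.out).2 <| by
    rw [← map_natCast (algebraMap K T), CharP.cast_eq_zero, map_zero]

theorem isReduced_of_injective_frobenius (p : ℕ) [hp : Fact p.Prime] {R : Type*} [CommRing R]
    [CharP R p] (h : Function.Injective (frobenius R p)) : IsReduced R :=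
  (isReduced_iff_pow_one_lt p hp.1.one_lt).2 fun a ha =>
    h (by rw [frobenius_def, ha, map_zero])

theorem injective_of_etale_of_comp_eq_pow {Q T S : Type*} [CommRing Q] [CommRing T] [CommRing S]
    [Algebra Q T] [Algebra Q S] [Algebra.Etale Q T] [Algebra.Etale Q S] (f : T →ₐ[Q] S)
    (g : S →+* T) {m : ℕ} (hm : 0 < m) (hgf : ∀ t, g (f t) = t ^ m) : Function.Injective f := by
  let : Algebra T S := f.toRingHom.toAlgebra
  have : IsScalarTower Q T S := IsScalarTower.of_algebraMap_eq fun q => (f.commutes q).symm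
  have : Algebra.Etale T S := .of_restrictScalars Q T S
  have : Module.FaithfullyFlat T S := by
    refine .of_comap_surjective fun I => ⟨PrimeSpectrum.comap g I, PrimeSpectrum.ext ?_⟩
    ext t
    change g (f t) ∈ I.asIdeal ↔ t ∈ I.asIdeal
    rw [hgf]
    exact I.isPrime.pow_mem_iff_mem m hm
  exact FaithfulSMul.algebraMap_injective T S

-- The base change `μ : Q ⊗ R → S` of `ψ` is a morphism of étale `Q`-algebras having a left inverse
-- up to Frobenius, so it is faithfully flat.
theorem injective_of_etale_of_frobenius (p : ℕ) [hp : Fact p.Prime] {P Q R S : Type*} [CommRing P]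
    [CommRing Q] [CommRing R] [CommRing S] [CharP Q p] [Algebra P Q] [Algebra P R]
    [Algebra Q S] [Algebra.Etale P R] [Algebra.Etale Q S] (ψ : R →+* S) (κ : S →+* R)
    (hPQ : Function.Injective (algebraMap P Q))
    (hψ : ∀ a, ψ (algebraMap P R a) = algebraMap Q S (algebraMap P Q a))
    (hκψ : ∀ r, κ (ψ r) = r ^ p)
    (hκ : ∀ q, ∃ a, algebraMap P R a = κ (algebraMap Q S q) ∧ algebraMap P Q a = q ^ p) :
    Function.Injective ψ := by
  have hincl : Function.Injective (Algebra.TensorProduct.includeRight : R →ₐ[P] Q ⊗[P] R) :=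
    Algebra.TensorProduct.includeRight_injective hPQ
  rcases subsingleton_or_nontrivial (Q ⊗[P] R) with hsub | hnon
  · have := hincl.subsingleton
    exact Function.injective_of_subsingleton _
  have : CharP (Q ⊗[P] R) p := charP_of_algebra p Q
  let : Algebra P S := ((algebraMap Q S).comp (algebraMap P Q)).toAlgebra
  have : IsScalarTower P Q S := IsScalarTower.of_algebraMap_eq fun _ => rfl
  let ψ' : R →ₐ[P] S := { ψ with commutes' := hψ }
  let μ : Q ⊗[P] R →ₐ[Q] S :=
    Algebra.TensorProduct.lift (Algebra.ofId Q S) ψ' fun _ _ => Commute.all _ _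
  have hμ (q : Q) (r : R) : μ (q ⊗ₜ r) = algebraMap Q S q * ψ r := rfl
  have hκμ (t : Q ⊗[P] R) : (1 : Q) ⊗ₜ[P] κ (μ t) = t ^ p := by
    induction t using TensorProduct.induction_on with
    | zero => rw [map_zero, map_zero, TensorProduct.tmul_zero, zero_pow hp.out.ne_zero]
    | add a b ha hb => rw [map_add, map_add, TensorProduct.tmul_add, ha, hb, add_pow_char]
    | tmul q r =>
      obtain ⟨a, ha, hq⟩ := hκ q
      rw [hμ, map_mul, hκψ, ← ha, Algebra.TensorProduct.tmul_pow, ← hq, ← Algebra.smul_def,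
        TensorProduct.tmul_smul, TensorProduct.smul_tmul', Algebra.smul_def, mul_one]
  have hμ_inj : Function.Injective μ := injective_of_etale_of_comp_eq_pow μ
    (Algebra.TensorProduct.includeRight.toRingHom.comp κ) hp.out.pos hκμ
  have hψμ (r : R) : μ (1 ⊗ₜ r) = ψ r := by rw [hμ, map_one, one_mul]
  exact fun r r' hr => hincl (hμ_inj ((hψμ r).trans (hr.trans (hψμ r').symm)))

theorem injective_frobenius_of_etale (p : ℕ) [Fact p.Prime] {P R : Type*} [CommRing P] [CommRing R]
    [CharP P p] [CharP R p] [algPR : Algebra P R] [hPR : Algebra.Etale P R]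
    (h : Function.Injective (frobenius P p)) : Function.Injective (frobenius R p) :=
  -- `Q` is `P`, regarded as an algebra over itself through Frobenius.
  @injective_of_etale_of_frobenius p _ P P R R _ _ _ _ _ (frobenius P p).toAlgebra algPR algPR
    hPR hPR (frobenius R p) (RingHom.id R) h (fun a => ((algebraMap P R).map_frobenius p a).symm)
    (fun _ => rfl) fun q => ⟨q, rfl, rfl⟩

theorem isReduced_of_isStandardSmooth (p : ℕ) [Fact p.Prime] (k : Type*) {R : Type*} [CommRing k]
    [CharP k p] [PerfectRing k p] [CommRing R] [Algebra k R] [h : Algebra.IsStandardSmooth k R] :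
    IsReduced R := by
  rcases subsingleton_or_nontrivial R with _ | _
  · infer_instance
  have : CharP R p := charP_of_algebra p k
  obtain ⟨m, g, -, hg⟩ := RingHom.IsStandardSmooth.exists_etale_mvPolynomial
    (f := algebraMap k R) (by rwa [RingHom.isStandardSmooth_algebraMap])
  have : IsReduced k := isReduced_of_injective_frobenius p (injective_frobenius k p)
  let : Algebra (MvPolynomial (Fin m) k) R := g.toAlgebra
  have : Algebra.Etale (MvPolynomial (Fin m) k) R := hg
  exact isReduced_of_injective_frobenius p
    (injective_frobenius_of_etale p (frobenius_inj (MvPolynomial (Fin m) k) p))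

end Reduced

section Generation

open scoped TensorProduct

variable {p : ℕ} [hp : Fact p.Prime]

-- The ideal of the diagonal is idempotent because `R` is unramified over `C`, and nil because
-- `(1 ⊗ s - s ⊗ 1) ^ p = 0`.
theorem isEpi_of_formallyUnramified_of_pow_mem {C R : Type*} [CommRing C] [CommRing R] [CharP R p]
    [Algebra C R] [Algebra.FiniteType C R] [Algebra.FormallyUnramified C R]
    (hC : ∀ r : R, r ^ p ∈ (algebraMap C R).range) : Algebra.IsEpi C R := by
  have hidem : IsIdempotentElem (KaehlerDifferential.ideal C R) :=
    (Ideal.cotangent_subsingleton_iff _).1 (inferInstanceAs (Subsingleton (Ω[R⁄C])))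
  have hnil : IsNilpotent (KaehlerDifferential.ideal C R) := by
    rw [(KaehlerDifferential.ideal_fg C R).isNilpotent_iff_le_nilradical,
      ← KaehlerDifferential.span_range_eq_ideal, Ideal.span_le]
    rintro _ ⟨s, rfl⟩
    rcases subsingleton_or_nontrivial (R ⊗[C] R) with _ | _
    · exact ⟨0, Subsingleton.elim _ _⟩
    have : CharP (R ⊗[C] R) p := charP_of_algebra p R
    obtain ⟨c, hc⟩ := hC s
    refine ⟨p, Ideal.mem_bot.2 ?_⟩
    rw [sub_pow_char, Algebra.TensorProduct.tmul_pow, Algebra.TensorProduct.tmul_pow, one_pow,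
      ← hc, sub_eq_zero, Algebra.algebraMap_eq_smul_one, TensorProduct.smul_tmul]
  obtain ⟨m, hm⟩ := hnil
  have hbot : KaehlerDifferential.ideal C R = ⊥ := by
    rw [← hidem.pow_succ_eq m, pow_succ, hm, zero_mul, Ideal.zero_eq_bot]
  rw [Algebra.isEpi_iff_forall_one_tmul_eq]
  intro a
  rw [← sub_eq_zero, ← Ideal.mem_bot, ← hbot, ← KaehlerDifferential.span_range_eq_ideal]
  exact Ideal.subset_span ⟨a, rfl⟩

variable {k K R : Type*} [CommRing k] [CommRing K] [CommRing R] [Algebra k K] [Algebra k R]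
  [Algebra K R] [IsScalarTower k K R]

variable (k) in
theorem formallyUnramified_adjoin_of_span_eq_top {s : Set R}
    (hs : Submodule.span R (KaehlerDifferential.D k R '' s) = ⊤) :
    Algebra.FormallyUnramified (Algebra.adjoin K s) R := by
  let C := Algebra.adjoin K s
  have hzero : KaehlerDifferential.map k C R R = 0 := by
    refine LinearMap.ext_on hs ?_
    rintro _ ⟨r, hr, rfl⟩
    rw [KaehlerDifferential.map_D, LinearMap.zero_apply]
    exact (KaehlerDifferential.D C R).map_algebraMap ⟨r, Algebra.subset_adjoin hr⟩
  refine ⟨subsingleton_of_forall_eq 0 fun ω => ?_⟩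
  obtain ⟨η, rfl⟩ := KaehlerDifferential.map_surjective k C R ω
  rw [hzero, LinearMap.zero_apply]

theorem adjoin_eq_top_of_span_eq_top [CharP R p] [Algebra.FiniteType k R]
    (hK : ∀ r : R, r ^ p ∈ (algebraMap K R).range) {s : Set R}
    (hs : Submodule.span R (KaehlerDifferential.D k R '' s) = ⊤) : Algebra.adjoin K s = ⊤ := by
  let C := Algebra.adjoin K s
  have hC (r : R) : r ^ p ∈ (algebraMap C R).range := by
    obtain ⟨c, hc⟩ := hK r
    exact ⟨algebraMap K C c, hc⟩
  have : Algebra.FormallyUnramified C R := formallyUnramified_adjoin_of_span_eq_top k hs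
  have : Algebra.FiniteType C R := .of_restrictScalars_finiteType k C R
  have : Algebra.IsIntegral C R := ⟨fun r => by
    obtain ⟨c, hc⟩ := hC r
    exact .of_pow hp.1.pos (hc ▸ isIntegral_algebraMap)⟩
  have : Module.Finite C R := Algebra.IsIntegral.finite
  have hsurj := Algebra.isEpi_iff_surjective_algebraMap_of_finite.1
    (isEpi_of_formallyUnramified_of_pow_mem hC)
  refine eq_top_iff.2 fun r _ => ?_
  obtain ⟨c, rfl⟩ := hsurj r
  exact c.2

variable (k) in
theorem adjoin_range_frobenius_eq_top_of_span_eq_top [CharP k p] [PerfectRing k p] [CharP R p]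
    [Algebra.FiniteType k R] {s : Set R}
    (hs : Submodule.span R (KaehlerDifferential.D k R '' s) = ⊤) :
    Algebra.adjoin (frobenius R p).range s = ⊤ := by
  have hmem (c : k) : algebraMap k R c ∈ (frobenius R p).range := by
    obtain ⟨c, rfl⟩ := (PerfectRing.bijective_frobenius (p := p)).2 c
    exact ⟨algebraMap k R c, ((algebraMap k R).map_frobenius p c).symm⟩
  let : Algebra k (frobenius R p).range := ((algebraMap k R).codRestrict _ hmem).toAlgebra
  have : IsScalarTower k (frobenius R p).range R := .of_algebraMap_eq fun _ => rfl
  exact adjoin_eq_top_of_span_eq_top (k := k) (fun r => ⟨⟨r ^ p, r, rfl⟩, rfl⟩) hs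

end Generation

theorem span_kaehlerDifferential_image_eq_top (A k : Type*) {B R : Type*} [CommRing A] [CommRing k]
    [CommRing B] [CommRing R] [Algebra A k] [Algebra A B] [Algebra A R] [Algebra k R] [Algebra B R]
    [IsScalarTower A k R] [IsScalarTower A B R] (hBR : Function.Surjective (algebraMap B R))
    {s : Set B} (hs : Submodule.span B (KaehlerDifferential.D A B '' s) = ⊤) :
    Submodule.span R (KaehlerDifferential.D k R '' (algebraMap B R '' s)) = ⊤ := by
  refine Submodule.restrictScalars_injective B _ _ (eq_top_iff.2 ?_)
  rw [← LinearMap.range_eq_top.2 (KaehlerDifferential.map_surjective_of_surjective A k B R hBR),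
    LinearMap.range_eq_map, ← hs, Submodule.map_span, Submodule.span_le]
  rintro _ ⟨_, ⟨b, hb, rfl⟩, rfl⟩
  rw [KaehlerDifferential.map_D]
  exact Submodule.subset_span ⟨_, ⟨b, hb, rfl⟩, rfl⟩

section StandardSmooth

theorem exists_basis_kaehlerDifferential (A B : Type*) [CommRing A]
    [CommRing B] [Algebra A B] [h : Algebra.IsStandardSmooth A B] :
    ∃ (ι : Type) (_ : Finite ι) (x : ι → B) (b : Module.Basis ι B (Ω[B⁄A])),
      ∀ i, b i = KaehlerDifferential.D A B (x i) := by
  obtain ⟨_, _, _, _, ⟨P⟩⟩ := h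
  exact ⟨_, inferInstance, _, P.basisKaehler, P.basisKaehler_apply⟩

variable {p n : ℕ} [Fact p.Prime] {A k B R : Type*} [CommRing A] [CommRing k] [CommRing B]
  [CommRing R] [Algebra A k] [Algebra A B] [Algebra A R] [Algebra k R] [Algebra B R]
  [IsScalarTower A k R] [IsScalarTower A B R]

omit [Fact p.Prime] in
theorem IsFlatThickening.exists_derivation (h : IsFlatThickening p n (algebraMap B R))
    (d : Derivation A B B) :
    ∃ D : Derivation A R R, ∀ b, algebraMap B R (d b) = D (algebraMap B R b) := by
  have hker (b : B) (hb : IsScalarTower.toAlgHom A B R b = 0) :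
      IsScalarTower.toAlgHom A B R (d b) = 0 := by
    obtain ⟨c, rfl⟩ := (h.map_eq_zero_iff b).1 hb
    refine (h.map_eq_zero_iff _).2 ⟨d c, ?_⟩
    rw [d.leibniz, d.map_natCast, smul_zero, add_zero, smul_eq_mul]
  exact ⟨Derivation.liftOfSurjective (f := IsScalarTower.toAlgHom A B R) h.surjective hker,
    fun b => (Derivation.liftOfSurjective_apply (f := IsScalarTower.toAlgHom A B R)
      h.surjective hker b).symm⟩

variable [CharP k p] [PerfectRing k p]

theorem IsFlatThickening.exists_isPBasis [CharP R p] [Algebra.FiniteType k R]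
    (h : IsFlatThickening p n (algebraMap B R)) {ι : Type*} {x : ι → B}
    (b : Module.Basis ι B (Ω[B⁄A])) (hb : ∀ i, b i = KaehlerDifferential.D A B (x i)) :
    ∃ D : ι → Derivation (frobenius R p).range R R,
      IsPBasis p (frobenius R p).range (algebraMap B R ∘ x) D ∧
      ∀ i a, algebraMap B R ((b.coord i).compDer (KaehlerDifferential.D A B) a) =
        D i (algebraMap B R a) := by
  choose D hD using fun i => h.exists_derivation ((b.coord i).compDer (KaehlerDifferential.D A B))
  have hDx (i j : ι) : D i (algebraMap B R (x j)) = algebraMap B R (b.coord i (b j)) := by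
    rw [← hD, hb]
    rfl
  have hD_pow (i : ι) (c : (frobenius R p).range) : D i (algebraMap _ R c) = 0 := by
    obtain ⟨_, a, rfl⟩ := c
    exact derivation_pow_char_eq_zero (D i) a
  refine ⟨fun i => derivationOver _ (D i) (hD_pow i), ⟨fun i => ?_, fun i j hij => ?_,
    fun i => ⟨⟨_, _, rfl⟩, rfl⟩, ?_⟩, hD⟩
  · refine (hDx i i).trans ?_
    rw [b.coord_apply, b.repr_self, Finsupp.single_eq_same, map_one]
  · refine (hDx i j).trans ?_
    rw [b.coord_apply, b.repr_self, Finsupp.single_eq_of_ne hij, map_zero]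
  · rw [Set.range_comp]
    refine adjoin_range_frobenius_eq_top_of_span_eq_top k
      (span_kaehlerDifferential_image_eq_top A k h.surjective ?_)
    rw [← Set.range_comp, ← b.span_eq]
    exact congrArg _ (congrArg _ (funext fun i => (hb i).symm))

theorem IsFlatThickening.range_ghostHom_eq_ker [Algebra.IsStandardSmooth A B]
    [Algebra.IsStandardSmooth k R] (h : IsFlatThickening p n (algebraMap B R)) :
    Set.range h.ghostHom = {b | KaehlerDifferential.D A B b = 0} := by
  have : IsReduced R := isReduced_of_isStandardSmooth p k
  rcases subsingleton_or_nontrivial R with _ | _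
  · have := h.subsingleton
    exact Set.ext fun a => Subsingleton.elim a 0 ▸
      ⟨fun _ => map_zero _, fun _ => ⟨0, map_zero _⟩⟩
  have : CharP R p := charP_of_algebra p k
  obtain ⟨ι, _, x, b, hb⟩ := exists_basis_kaehlerDifferential A B
  obtain ⟨D, hD, hd⟩ := h.exists_isPBasis (k := k) b hb
  rw [h.range_ghostHom hD hd]
  refine Set.ext fun a => ⟨fun ha => ?_, fun ha i => ?_⟩
  · exact b.forall_coord_eq_zero_iff.1 ha
  · exact (congrArg (b.coord i) ha).trans (map_zero _)

end StandardSmooth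

section Sheaf

variable {C : Type*} [Category.{u} C] {FC : C → C → Type*} {CC : C → Type u}
  [∀ A B, FunLike (FC A B) (CC A) (CC B)] [ConcreteCategory.{u} C FC] [Limits.HasLimits C]
  [(forget C).ReflectsIsomorphisms] [Limits.PreservesLimits (forget C)] {X : TopCat.{u}}

theorem mem_range_app_of_locally_mem_range {F G : TopCat.Sheaf C X} (φ : F ⟶ G)
    (hφ : ∀ U, Function.Injective (φ.hom.app (op U))) {U : Opens X} (t : ToType (G.obj.obj (op U)))
    (ht : ∀ x ∈ U, ∃ (V : Opens X) (h : V ≤ U), x ∈ V ∧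
      G.obj.map (homOfLE h).op t ∈ Set.range (φ.hom.app (op V))) :
    t ∈ Set.range (φ.hom.app (op U)) := by
  have naturality : ∀ {V W : Opens X} (g : V ⟶ W) (s : ToType (F.obj.obj (op W))),
      φ.hom.app (op V) (F.obj.map g.op s) = G.obj.map g.op (φ.hom.app (op W) s) := fun g s => by
    simp only [← ConcreteCategory.comp_apply, φ.hom.naturality]
  choose V hVU hxV s hs using fun x : U => ht x x.2
  have hcover : U ≤ iSup V := fun x hx => Opens.mem_iSup.2 ⟨⟨x, hx⟩, hxV _⟩
  have compatible : TopCat.Presheaf.IsCompatible F.obj V s := fun x y => hφ _ <| by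
    rw [naturality, naturality, hs, hs]
    simp only [← ConcreteCategory.comp_apply, ← G.obj.map_comp, ← op_comp]
    rfl
  obtain ⟨r, hr, -⟩ := F.existsUnique_gluing' V U (fun x => homOfLE (hVU x)) hcover s compatible
  refine ⟨r, G.eq_of_locally_eq' V U (fun x => homOfLE (hVU x)) hcover _ _ fun x => ?_⟩
  rw [← naturality, hr, hs]

end Sheaf

section Abelian

variable {X : TopCat.{u}} (P : X.Presheaf AddCommGrpCat.{u})

theorem toSheafify_app_eq_zero_iff {U : Opens X} (ω : P.obj (op U)) :
    (toSheafify (Opens.grothendieckTopology X) P).app (op U) ω = 0 ↔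
      ∀ x ∈ U, ∃ (V : Opens X) (h : V ≤ U), x ∈ V ∧ P.map (homOfLE h).op ω = 0 := by
  constructor
  · intro h x hx
    obtain ⟨V, g, hg, hxV⟩ := Presheaf.equalizerSieve_mem (Opens.grothendieckTopology X)
      (toSheafify (Opens.grothendieckTopology X) P) ω 0 (h.trans (map_zero _).symm) x hx
    exact ⟨V, leOfHom g, hxV, hg.trans (map_zero _)⟩
  · intro h
    refine TopCat.Presheaf.section_ext (F := (presheafToSheaf _ _).obj P) U _ 0 fun x hx => ?_
    obtain ⟨V, hVU, hxV, hV⟩ := h x hx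
    refine TopCat.Presheaf.germ_ext _ V hxV (homOfLE hVU) (homOfLE hVU) ?_
    have naturality := congr($((toSheafify (Opens.grothendieckTopology X) P).naturality
      (homOfLE hVU).op) ω)
    simp only [ConcreteCategory.comp_apply, hV, map_zero] at naturality
    exact naturality.symm.trans (map_zero _).symm

end Abelian

theorem eq_of_forall_isAffineOpen_map_eq {X : Scheme.{u}} {U : X.Opens} {s t : Γ(X, U)}
    (H : ∀ (V : X.Opens) (h : V ≤ U), IsAffineOpen V →
      X.presheaf.map (homOfLE h).op s = X.presheaf.map (homOfLE h).op t) : s = t :=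
  X.IsSheaf.section_ext fun _ hx => by
    obtain ⟨V, hV, hxV, hVU⟩ := exists_isAffineOpen_mem_and_subset hx
    exact ⟨V, hVU, hxV, H V hVU hV⟩

section Differentials

variable {R : Type u} [CommRing R] {X : Scheme.{u}} (f : X ⟶ Spec (CommRingCat.of R))

theorem presheaf_map_algMap {U V : X.Opens} (h : V ≤ U) (a : R) :
    X.presheaf.map (homOfLE h).op (algMap f U a) = algMap f V a :=
  congr($((structureMap f).naturality (homOfLE h).op) a).symm

theorem kaehlerDifferential_D_map_eq_zero {U V : X.Opens} (h : V ≤ U) {s : Γ(X, U)}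
    (hs : letI := (algMap f U).toAlgebra; KaehlerDifferential.D R Γ(X, U) s = 0) :
    letI := (algMap f V).toAlgebra
    KaehlerDifferential.D R Γ(X, V) (X.presheaf.map (homOfLE h).op s) = 0 := by
  let d := PresheafOfModules.DifferentialsConstruction.derivation' (structureMap f)
  exact ((d.d_map (homOfLE h).op s).trans (congrArg _ hs)).trans (map_zero _)

theorem deRhamD_eq_zero_iff (U : X.Opens) (s : Γ(X, U)) : deRhamD f U s = 0 ↔
    ∀ x ∈ U, ∃ (V : X.Opens) (h : V ≤ U), x ∈ V ∧
      letI := (algMap f V).toAlgebra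
      KaehlerDifferential.D R Γ(X, V) (X.presheaf.map (homOfLE h).op s) = 0 := by
  let d := PresheafOfModules.DifferentialsConstruction.derivation' (structureMap f)
  refine (toSheafify_app_eq_zero_iff (kaehlerPresheaf f).presheaf (d.d (X := op U) s)).trans ?_
  refine forall₂_congr fun x _ => exists₂_congr fun V h => and_congr_right fun _ => ?_
  exact Eq.congr_left (d.d_map (homOfLE h).op s).symm

end Differentials

section Smooth

variable {R : Type u} [CommRing R] {X : Scheme.{u}} (f : X ⟶ Spec (CommRingCat.of R))

theorem flat_algMap [Flat f] {U : X.Opens} (hU : IsAffineOpen U) : (algMap f U).Flat :=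
  RingHom.Flat.comp (f := (Scheme.ΓSpecIso (CommRingCat.of R)).inv.hom)
    (RingHom.Flat.of_bijective
      (Scheme.ΓSpecIso (CommRingCat.of R)).symm.commRingCatIsoToRingEquiv.bijective)
    (f.flat_appLE (isAffineOpen_top _) hU le_top)

variable [Smooth f]

theorem smooth_algMap {U : X.Opens} (hU : IsAffineOpen U) : (algMap f U).Smooth :=
  RingHom.Smooth.comp (f := (Scheme.ΓSpecIso (CommRingCat.of R)).inv.hom)
    (RingHom.Smooth.of_bijective
      (Scheme.ΓSpecIso (CommRingCat.of R)).symm.commRingCatIsoToRingEquiv.bijective)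
    (f.smooth_appLE (isAffineOpen_top _) hU le_top)

theorem exists_isAffineOpen_isStandardSmooth_algMap {U : X.Opens} {x : X} (hx : x ∈ U) :
    ∃ V : X.Opens, IsAffineOpen V ∧ x ∈ V ∧ V ≤ U ∧ (algMap f V).IsStandardSmooth := by
  obtain ⟨W, hW, hxW, hWU⟩ := exists_isAffineOpen_mem_and_subset hx
  let : Algebra R Γ(X, W) := (algMap f W).toAlgebra
  have : Algebra.Smooth R Γ(X, W) := smooth_algMap f hW
  obtain ⟨s, hs, hst⟩ := Algebra.Smooth.exists_span_eq_top_isStandardSmooth R Γ(X, W)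
  obtain ⟨⟨g, hg⟩, hxg⟩ := Opens.mem_iSup.1 (hW.self_le_iSup_basicOpen_iff.2 hs hxW)
  refine ⟨X.basicOpen g, hW.basicOpen g, hxg, (X.basicOpen_le g).trans hWU, ?_⟩
  let : Algebra R Γ(X, X.basicOpen g) := (algMap f (X.basicOpen g)).toAlgebra
  have : IsScalarTower R Γ(X, W) Γ(X, X.basicOpen g) :=
    IsScalarTower.of_algebraMap_eq fun a => (presheaf_map_algMap f (X.basicOpen_le g) a).symm
  have := hW.isLocalization_basicOpen g
  have := hst g hg
  exact Algebra.IsStandardSmooth.of_algEquiv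
    ((IsLocalization.algEquiv (Submonoid.powers g) (Localization.Away g)
      Γ(X, X.basicOpen g)).restrictScalars R)

end Smooth

theorem isReduced_of_smooth (p : ℕ) [Fact p.Prime] {k : Type u} [CommRing k] [CharP k p]
    [PerfectRing k p] {X : Scheme.{u}} (f : X ⟶ Spec (CommRingCat.of k)) [Smooth f] :
    IsReduced X where
  component_reduced U := by
    refine ⟨fun s hs => X.IsSheaf.section_ext fun x hx => ?_⟩
    obtain ⟨V, -, hxV, hVU, hV⟩ := exists_isAffineOpen_isStandardSmooth_algMap f hx
    algebraize [algMap f V]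
    have : _root_.IsReduced Γ(X, V) := isReduced_of_isStandardSmooth p k
    exact ⟨V, hVU, hxV, ((hs.map (X.presheaf.map (homOfLE hVU).op).hom).eq_zero).trans
      (map_zero _).symm⟩

section BaseChange

variable {A k : Type u} [CommRing A] [CommRing k] {π : A →+* k} {X X' : Scheme.{u}}
  {f : X ⟶ Spec (CommRingCat.of k)} {f' : X' ⟶ Spec (CommRingCat.of A)} {i : X ⟶ X'}
  (hi : IsPullback i f f' (Spec.map (CommRingCat.ofHom π)))

include hi

theorem isPushout_algMap {U : X'.Opens} (hU : IsAffineOpen U) :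
    IsPushout (CommRingCat.ofHom π) (CommRingCat.ofHom (algMap f' U))
      (CommRingCat.ofHom (algMap f (i ⁻¹ᵁ U))) (i.app U) := by
  have hpushout := (isIso_pushoutSection_iff hi (US := ⊤) (UT := ⊤) (UX := U) le_top le_top
    (UY := i ⁻¹ᵁ U) (by simp)).1 (isIso_pushoutSection_of_isAffineOpen hi _ _ _
      (isAffineOpen_top _) (isAffineOpen_top _) hU)
  refine hpushout.flip.of_iso (Scheme.ΓSpecIso _) (Scheme.ΓSpecIso _) (Iso.refl _) (Iso.refl _)
    ?_ ?_ ?_ ?_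
  · rw [← Scheme.ΓSpecIso_naturality]
    congr 1
  · exact (Category.comp_id _).trans ((Scheme.ΓSpecIso (.of A)).hom_inv_id_assoc _).symm
  · exact (Category.comp_id _).trans ((Scheme.ΓSpecIso (.of k)).hom_inv_id_assoc _).symm
  · rw [Scheme.Hom.appLE_eq_app]
    exact (Category.comp_id _).trans (Category.id_comp _).symm

theorem isHomeomorph_of_isPullback (hπ : Function.Surjective π)
    (hker : RingHom.ker π ≤ nilradical A) : IsHomeomorph i := by
  have : IsClosedImmersion (Spec.map (CommRingCat.ofHom π)) :=
    IsClosedImmersion.spec_of_surjective _ hπ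
  have range_comap : Set.range (PrimeSpectrum.comap π) = Set.univ := by
    rwa [range_comap_of_surjective _ _ hπ, PrimeSpectrum.zeroLocus_eq_univ_iff]
  have : Surjective (Spec.map (CommRingCat.ofHom π)) := ⟨Set.range_eq_univ.1 range_comap⟩
  have : IsClosedImmersion i := MorphismProperty.of_isPullback hi.flip ‹_›
  have : Surjective i := MorphismProperty.of_isPullback hi.flip ‹_›
  exact isHomeomorph_iff_isEmbedding_surjective.2 ⟨i.isEmbedding, i.surjective⟩

end BaseChange

section Pushout

variable {p : ℕ} [Fact p.Prime] {n : ℕ} {A k B R : Type u} [CommRing A] [CommRing k] [CommRing B]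
  [CommRing R] {π : A →+* k} {a : A →+* B} {b : k →+* R} {ρ : B →+* R}
  (H : IsPushout (CommRingCat.ofHom π) (CommRingCat.ofHom a) (CommRingCat.ofHom b)
    (CommRingCat.ofHom ρ))

include H

omit [Fact p.Prime] in
theorem isFlatThickening_of_isPushout (ha : a.Flat) (h : IsFlatThickening p n π) :
    IsFlatThickening p n ρ := by
  have comm : b.comp π = ρ.comp a := congrArg CommRingCat.Hom.hom H.w
  algebraize [π, a, b, ρ, b.comp π]
  have : IsScalarTower A B R := IsScalarTower.of_algebraMap_eq' comm
  have : Algebra.IsPushout A k B R := CommRingCat.isPushout_iff_isPushout.1 H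
  exact IsFlatThickening.baseChange (A := A) (k := k) h

theorem range_ghostHom_of_isPushout [CharP k p] [PerfectRing k p] (ha : a.IsStandardSmooth)
    (h : IsFlatThickening p n ρ) :
    letI := a.toAlgebra
    Set.range h.ghostHom = {s | KaehlerDifferential.D A B s = 0} := by
  have comm : b.comp π = ρ.comp a := congrArg CommRingCat.Hom.hom H.w
  algebraize [π, a, b, ρ, b.comp π]
  have : IsScalarTower A B R := IsScalarTower.of_algebraMap_eq' comm
  have : Algebra.IsPushout A k B R := CommRingCat.isPushout_iff_isPushout.1 H
  have : Algebra.IsStandardSmooth k R := .of_algEquiv (Algebra.IsPushout.equiv A k B R)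
  exact IsFlatThickening.range_ghostHom_eq_ker (k := k) h

end Pushout

section TildeF

variable {p : ℕ} [Fact p.Prime] {n : ℕ} {X X' : Scheme.{u}} {i : X ⟶ X'}

theorem onSections_map (F : wittSheafOn p n i ⟶ X'.sheaf) {U V : X'.Opens} (h : V ≤ U)
    (x : TruncatedWittVector p n Γ(X, i ⁻¹ᵁ U)) :
    onSections F V (TruncatedWittVector.map (X.presheaf.map (homOfLE (i.preimage_mono h)).op).hom x)
      = X'.presheaf.map (homOfLE h).op (onSections F U x) :=
  congr($(F.hom.naturality (homOfLE h).op) x)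

theorem eq_of_isTildeF_of_surjective_app
    {φ ψ : (wittSheafOn p n i).obj ⋙ forget CommRingCat.{u} ⟶
      X'.presheaf ⋙ forget CommRingCat.{u}} (hφ : IsTildeF p n i φ) (hψ : IsTildeF p n i ψ)
    (hi : ∀ U : X'.Opens, IsAffineOpen U → Function.Surjective (i.app U)) : φ = ψ := by
  ext U x
  refine eq_of_forall_isAffineOpen_map_eq (U := U.unop) fun V hVU hV => ?_
  let xV : TruncatedWittVector p n Γ(X, i ⁻¹ᵁ V) :=
    TruncatedWittVector.map (X.presheaf.map (homOfLE (i.preimage_mono hVU)).op).hom x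
  choose y hy using fun j : Fin n => hi V hV (xV.coeff j)
  have agree : φ.app (op V) xV = ψ.app (op V) xV := (hφ V xV y hy).trans (hψ V xV y hy).symm
  exact congr($(φ.naturality (homOfLE hVU).op) x).symm.trans
    (agree.trans congr($(ψ.naturality (homOfLE hVU).op) x))

variable (p n i) in
/-- A morphism of schemes `i : X ⟶ X'` is a flat thickening if it is one, in the sense of
`IsFlatThickening`, on the rings of sections over every affine open subset of `X'`. -/
def IsFlatThickeningOnAffines : Prop :=
  ∀ U : X'.affineOpens, IsFlatThickening p n (i.app U).hom

namespace IsFlatThickeningOnAffines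

variable (h : IsFlatThickeningOnAffines p n i)

/-- The morphism `F̃ⁿ : W_n 𝒪_X → 𝒪_{X'}`, glued from the ring homomorphisms
`IsFlatThickening.ghostHom` over the affine open subsets of `X'`. -/
noncomputable def tildeF : wittSheafOn p n i ⟶ X'.sheaf where
  hom := TopCat.Sheaf.restrictHomEquivHom (B := ((↑) : X'.affineOpens → X'.Opens)) _ X'.sheaf
    (by simpa using X'.isBasis_affineOpens)
    { app U := CommRingCat.ofHom (h U.unop).ghostHom
      naturality U V g := by
        ext x
        refine ((h U.unop).map_ghostHom (h V.unop) (g := (X'.presheaf.map g.unop.hom.op).hom)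
          (gbar := (X.presheaf.map ((Opens.map i.base).map g.unop.hom).op).hom) ?_ x).symm
        exact congrArg CommRingCat.Hom.hom (i.naturality g.unop.hom.op) }

theorem onSections_tildeF {U : X'.Opens} (hU : IsAffineOpen U) :
    onSections h.tildeF U = (h ⟨U, hU⟩).ghostHom :=
  congrArg CommRingCat.Hom.hom (TopCat.Sheaf.extend_hom_app (B := ((↑) : X'.affineOpens → X'.Opens))
    _ X'.sheaf _ _ ⟨U, hU⟩)

theorem isTildeF_tildeF :
    IsTildeF p n i (Functor.whiskerRight h.tildeF.hom (forget CommRingCat.{u})) := by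
  intro U x y hy
  refine eq_of_forall_isAffineOpen_map_eq fun V hVU hV => ?_
  refine (onSections_map h.tildeF hVU x).symm.trans ?_
  rw [h.onSections_tildeF hV, IsFlatThickening.ghostHom_apply _
    (y := fun j => X'.presheaf.map (homOfLE hVU).op (y j)) fun j => ?_]
  · simp only [map_sum, map_mul, map_pow, map_natCast]
  · rw [TruncatedWittVector.coeff_map, ← hy]
    exact congr($(i.naturality (homOfLE hVU).op) (y j))

include h in
theorem existsUnique_isTildeF : ∃! φ, IsTildeF p n i φ :=
  ⟨_, h.isTildeF_tildeF, fun _ hφ => eq_of_isTildeF_of_surjective_app hφ h.isTildeF_tildeF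
    fun U hU => (h ⟨U, hU⟩).surjective⟩

theorem onSections_tildeF_injective [IsReduced X] (U : X'.Opens) :
    Function.Injective (onSections h.tildeF U) :=
  TopCat.Presheaf.app_injective_of_stalkFunctor_map_injective (F := wittSheafOn p n i)
    h.tildeF.hom U fun x _ => TopCat.Presheaf.stalkFunctor_map_injective_of_isBasis
      X'.isBasis_affineOpens (fun V hV => by
        change Function.Injective (onSections h.tildeF V)
        rw [h.onSections_tildeF hV]
        exact (h ⟨V, hV⟩).ghostHom_injective) x

end IsFlatThickeningOnAffines

end TildeF

section Witt

variable {p : ℕ} [Fact p.Prime] {n : ℕ} [NeZero n] {k : Type u} [CommRing k] [CharP k p]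
  [PerfectRing k p] {X X' : Scheme.{u}} {f : X ⟶ Spec (CommRingCat.of k)}
  {f' : X' ⟶ Spec (CommRingCat.of (TruncatedWittVector p n k))} {i : X ⟶ X'}
  (hi : IsPullback i f f' (Spec.map (CommRingCat.ofHom
    (TruncatedWittVector.firstCoeff : TruncatedWittVector p n k →+* k))))

include hi

theorem isFlatThickeningOnAffines_of_isPullback [Flat f'] : IsFlatThickeningOnAffines p n i :=
  fun U => isFlatThickening_of_isPushout (isPushout_algMap hi U.2) (flat_algMap f' U.2)
    (isFlatThickening_firstCoeff p n k)

variable (h : IsFlatThickeningOnAffines p n i)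

theorem onSections_tildeF_map_algMap (U : X'.Opens) (a : TruncatedWittVector p n k) :
    onSections h.tildeF U (TruncatedWittVector.map (algMap f (i ⁻¹ᵁ U)) a) =
      algMap f' U ((TruncatedWittVector.frobeniusMap p n k)^[n] a) := by
  refine eq_of_forall_isAffineOpen_map_eq fun V hVU hV => ?_
  have comm : (i.app V).hom.comp (algMap f' V) =
      (algMap f (i ⁻¹ᵁ V)).comp TruncatedWittVector.firstCoeff :=
    congrArg CommRingCat.Hom.hom (isPushout_algMap hi hV).w.symm
  have restrict : TruncatedWittVector.map
      (X.presheaf.map (homOfLE (i.preimage_mono hVU)).op).hom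
      (TruncatedWittVector.map (algMap f (i ⁻¹ᵁ U)) a) =
      TruncatedWittVector.map (algMap f (i ⁻¹ᵁ V)) a :=
    TruncatedWittVector.ext fun j => presheaf_map_algMap f _ (a.coeff j)
  rw [← onSections_map, restrict, h.onSections_tildeF hV, presheaf_map_algMap,
    ← ghostHom_firstCoeff,
    (isFlatThickening_firstCoeff p n k).map_ghostHom (h ⟨V, hV⟩) comm]

theorem range_onSections_tildeF [Smooth f'] [IsReduced X] (U : X'.Opens) :
    Set.range (onSections h.tildeF U) = {s | deRhamD f' U s = 0} := by
  have range_eq {V : X'.Opens} (hV : IsAffineOpen V) (hst : (algMap f' V).IsStandardSmooth) :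
      letI := (algMap f' V).toAlgebra
      Set.range (onSections h.tildeF V) =
        {s | KaehlerDifferential.D (TruncatedWittVector p n k) Γ(X', V) s = 0} := by
    rw [h.onSections_tildeF hV]
    exact range_ghostHom_of_isPushout (isPushout_algMap hi hV) hst _
  ext s
  rw [Set.mem_ofPred_eq, deRhamD_eq_zero_iff]
  constructor
  · rintro ⟨x, rfl⟩ a ha
    obtain ⟨V, hV, haV, hVU, hst⟩ := exists_isAffineOpen_isStandardSmooth_algMap f' ha
    refine ⟨V, hVU, haV, ?_⟩
    rw [← onSections_map]
    exact (range_eq hV hst).le (Set.mem_range_self _)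
  · intro hs
    refine mem_range_app_of_locally_mem_range h.tildeF h.onSections_tildeF_injective s ?_
    intro a ha
    obtain ⟨W, hWU, haW, hW⟩ := hs a ha
    obtain ⟨V, hV, haV, hVW, hst⟩ := exists_isAffineOpen_isStandardSmooth_algMap f' haW
    refine ⟨V, hVW.trans hWU, haV, (range_eq hV hst).ge ?_⟩
    have hV := kaehlerDifferential_D_map_eq_zero f' hVW hW
    rwa [← CommRingCat.comp_apply, ← X'.presheaf.map_comp, ← op_comp] at hV

end Witt

theorem mainTheorem7 (p : ℕ) [Fact p.Prime] (n : ℕ) [NeZero n]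
    (k : Type u) [CommRing k] [CharP k p] [PerfectRing k p]
    {X X' : Scheme.{u}} (f : X ⟶ Spec (CommRingCat.of k)) [Smooth f]
    (f' : X' ⟶ Spec (CommRingCat.of (TruncatedWittVector p n k))) [Smooth f']
    (i : X ⟶ X')
    (hi : IsPullback i f f' (Spec.map (CommRingCat.ofHom
      (TruncatedWittVector.firstCoeff : TruncatedWittVector p n k →+* k)))) :
    IsHomeomorph i ∧
    (∃! φ, IsTildeF p n i φ) ∧
    ∃ F : wittSheafOn p n i ⟶ X'.sheaf,
      IsTildeF p n i (Functor.whiskerRight F.hom (forget CommRingCat.{u})) ∧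
      ∀ U : X'.Opens,
        (∀ (a : TruncatedWittVector p n k) (x : TruncatedWittVector p n Γ(X, i ⁻¹ᵁ U)),
          onSections F U (TruncatedWittVector.map (algMap f (i ⁻¹ᵁ U)) a * x) =
            algMap f' U ((TruncatedWittVector.frobeniusMap p n k)^[n] a) * onSections F U x) ∧
        Function.Injective (onSections F U) ∧
        Set.range (onSections F U) = {s : Γ(X', U) | deRhamD f' U s = 0} := by
  have : IsReduced X := isReduced_of_smooth p f
  have hW := isFlatThickening_firstCoeff p n k
  have h : IsFlatThickeningOnAffines p n i := isFlatThickeningOnAffines_of_isPullback hi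
  refine ⟨isHomeomorph_of_isPullback hi hW.surjective hW.ker_le_nilradical,
    h.existsUnique_isTildeF, h.tildeF, h.isTildeF_tildeF, fun U => ⟨fun a x => ?_,
      h.onSections_tildeF_injective U, range_onSections_tildeF hi h U⟩⟩
  rw [map_mul, onSections_tildeF_map_algMap hi h]
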